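/- Let $d\in\{1,2,3\}$ and let $D\subset\mathbb R^d$ be a nonempty bounded domain (open and connected) with Lipschitz boundary. Let $E_1,\dots,E_M\subset\partial D$, $M\ge 2$, be nonempty, connected, relatively open subsets of $\partial D$ with pairwise disjoint closures. Let $\mathcal H:=(H^1(D)\oplus\mathbb R^M)/\mathbb R$, where $(v,V)$ is identified with $(v+c,(V_1+c,\dots,V_M+c))$, $c\in\mathbb R$, be endowed with the norm $$\|(v,V)\|_{\mathcal H}^2:=\int_D|\nabla v|^2\,{\rm d}x+\sum_{k=1}^M\int_{E_k}(v-V_k)^2\,{\rm d}S,$$ where boundary values are understood in the sense of traces. Let $z_1,\dots,z_M>0$ and $I\in\mathbb R^M$ with $\sum_m I_m=0$. Let $\Upsilon:=(-1/2,1/2)^{\mathbb N}$ and $\mathscr F:=\{\nu\in\mathbb N_0^{\mathbb N}:|\nu|=\sum_j\nu_j<\infty\}$. Let the conductivity $a$ satisfy the following. (A1) $a(\cdot,y)\in L^\infty(D)$ for all $y\in\Upsilon$. (A2) All mixed partial derivatives $\partial_y^\nu a(\cdot,y)$, $\nu\in\mathscr F$, $y\in\Upsilon$, exist in $L^\infty(D)$,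 and there are constants $C_a,\sigma\ge1$ and a summable sequence $\rho=(\rho_j)_{j\ge1}$ of non-negative reals with $\|\partial_y^\nu a(\cdot,y)\|_{L^\infty(D)}\le C_a(|\nu|!)^\sigma\prod_j\rho_j^{\nu_j}$ (where $0^0:=1$) for all $\nu\in\mathscr F$ and $y\in\Upsilon$. (A3) There are constants $0<a_{\min}\le a_{\max}<\infty$ such that, for every $y\in\Upsilon$, $a_{\min}\le a(x,y)\le a_{\max}$ for almost every $x\in D$. For $y\in\Upsilon$ and $(w,W),(v,V)\in\mathcal H$ put $$B_y((w,W),(v,V)):=\int_D a(\cdot,y)\nabla w\cdot\nabla v\,{\rm d}x+\sum_{m=1}^M\frac1{z_m}\int_{E_m}(w-W_m)(v-V_m)\,{\rm d}S.$$ Then for every $y\in\Upsilon$ there is exactly one $(u(\cdot,y),U(y))\in\mathcal H$ with $$B_y((u(\cdot,y),U(y)),(v,V))=\sum_{m=1}^M I_mV_m\quad\text{for all }(v,V)\in\mathcal H,$$ and the following hold. 1. For all $j\ge1$ and $y\in\Upsilon$ the partial derivative $\partial_{y_j}(u(\cdot,y),U(y))$ exists in $\mathcal H$ (as the limit in $\mathcal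 H$ of difference quotients), and it is the unique element $(w,W)\in\mathcal H$ with $$B_y((w,W),(v,V))=-\int_D\partial_{y_j}a(\cdot,y)\,\nabla u(\cdot,y)\cdot\nabla v\,{\rm d}x\quad\text{for all }(v,V)\in\mathcal H.$$ 2. For all $\nu\in\mathscr F$ and $y\in\Upsilon$ the mixed partial derivative $\partial_y^\nu(u(\cdot,y),U(y))$ exists in $\mathcal H$, and it does not depend on the order of differentiation. -/

import Mathlib

open MeasureTheory Set Filter Topology
open scoped ContDiff ENNReal

noncomputable section

namespace PCEM

/-! ## Domains and electrodes -/

/-- Euclidean space `ℝ^d`. -/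
abbrev E (d : ℕ) : Type := EuclideanSpace ℝ (Fin d)

/-- `D` has a Lipschitz boundary: near every boundary point, in some direction `e`, the set `D`
is the part of the space strictly above the graph of a Lipschitz function `γ`, which is defined
on the hyperplane orthogonal to `e`. -/
def HasLipschitzBoundary {d : ℕ} (D : Set (E d)) : Prop :=
  ∀ x₀ ∈ frontier D, ∃ (e : E d) (r : ℝ) (K : NNReal) (γ : (ℝ ∙ e)ᗮ → ℝ),
    ‖e‖ = 1 ∧ 0 < r ∧ LipschitzWith K γ ∧
      ∀ x ∈ Metric.ball x₀ r,
        (x ∈ D ↔ γ ((ℝ ∙ e)ᗮ.orthogonalProjectionOnto x) < inner ℝ e x)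

/-- A nonempty, bounded domain (connected open set) in `ℝ^d` with Lipschitz boundary. -/
structure LipschitzDomain (d : ℕ) where
  carrier : Set (E d)
  isOpen : IsOpen carrier
  isConnected : IsConnected carrier
  isBounded : Bornology.IsBounded carrier
  lipschitz : HasLipschitzBoundary carrier

/-- Electrodes: connected, nonempty, relatively open subsets of the boundary of `D`, with
pairwise disjoint closures. -/
structure Electrodes {d : ℕ} (D : LipschitzDomain d) (M : ℕ) where
  set : Fin M → Set (E d)
  isRelOpen : ∀ k, ∃ O : Set (E d), IsOpen O ∧ set k = O ∩ frontier D.carrier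
  isConnected : ∀ k, IsConnected (set k)
  disjoint : ∀ i j, i ≠ j → Disjoint (closure (set i)) (closure (set j))

section Spaces

variable {d : ℕ} (D : LipschitzDomain d)

/-- Lebesgue measure on `D`. -/
abbrev volD : Measure (E d) := volume.restrict D.carrier

/-- The surface measure on the boundary of `D`, i.e. the `(d-1)`-dimensional Hausdorff measure
(normalised as usual, so that it is the Lebesgue measure on hyperplanes). -/
abbrev surface : Measure (E d) := (μHE[d - 1] : Measure (E d)).restrict (frontier D.carrier)

/-- `L²(D)`. -/
abbrev L2 : Type := Lp ℝ 2 (volD D)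

/-- `L²(D; ℝ^d)`. -/
abbrev L2vec : Type := Lp (E d) 2 (volD D)

/-- `L²(∂D)`. -/
abbrev L2bdry : Type := Lp ℝ 2 (surface D)

/-- `L^∞(D)`. -/
abbrev Linfty : Type := Lp ℝ ∞ (volD D)

instance : IsFiniteMeasure (volD D) :=
  ⟨by simpa using D.isBounded.measure_lt_top⟩

/-! ## The Sobolev space `H¹(D)` -/

/-- `G` is the weak gradient of `v` in `D`:
`∫_D v ∇φ = - ∫_D φ G` for all test functions `φ ∈ C_c^∞(D)`. -/
def IsWeakGradient (v : L2 D) (G : L2vec D) : Prop :=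
  ∀ φ : E d → ℝ, ContDiff ℝ ∞ φ → HasCompactSupport φ → tsupport φ ⊆ D.carrier →
    ∫ x in D.carrier, v x • gradient φ x = - ∫ x in D.carrier, φ x • G x

variable {D} in
theorem integrable_smul_gradient (v : L2 D) {φ : E d → ℝ} (hφ : ContDiff ℝ ∞ φ)
    (hc : HasCompactSupport φ) : Integrable (fun x => v x • gradient φ x) (volD D) := by
  have hcont : Continuous (gradient φ) := by
    have : Continuous (fderiv ℝ φ) := hφ.continuous_fderiv (by simp)
    exact (InnerProductSpace.toDual ℝ (E d)).symm.continuous.comp this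
  have hcs : HasCompactSupport (gradient φ) := by
    have := (hc.fderiv ℝ).comp_left (g := (InnerProductSpace.toDual ℝ (E d)).symm) (map_zero _)
    exact this
  have h2 : MemLp (gradient φ) 2 (volD D) :=
    (hcont.memLp_of_hasCompactSupport (μ := volume) hcs).restrict _
  exact memLp_one_iff_integrable.1 (h2.smul (Lp.memLp v))

variable {D} in
theorem integrable_smul_vec (G : L2vec D) {φ : E d → ℝ} (hφ : ContDiff ℝ ∞ φ)
    (hc : HasCompactSupport φ) : Integrable (fun x => φ x • G x) (volD D) := by
  have h2 : MemLp φ 2 (volD D) :=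
    (hφ.continuous.memLp_of_hasCompactSupport (μ := volume) hc).restrict _
  exact memLp_one_iff_integrable.1 ((Lp.memLp G).smul h2)

/-- The Sobolev space `H¹(D)`. An element is a function `v ∈ L²(D)` together with its weak
gradient `∇v ∈ L²(D; ℝ^d)`, which is determined by `v`. -/
def H1 : Submodule ℝ (L2 D × L2vec D) where
  carrier := {p | IsWeakGradient D p.1 p.2}
  zero_mem' := by
    intro φ _ _ _
    have h1 : (fun x => ((0 : L2 D) x) • gradient φ x) =ᵐ[volD D] 0 := by
      filter_upwards [Lp.coeFn_zero ℝ 2 (volD D)] with x hx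
      rw [hx]
      simp
    have h2 : (fun x => φ x • ((0 : L2vec D) x)) =ᵐ[volD D] 0 := by
      filter_upwards [Lp.coeFn_zero (E d) 2 (volD D)] with x hx
      rw [hx]
      simp
    show ∫ x, _ ∂(volD D) = - ∫ x, _ ∂(volD D)
    rw [Prod.fst_zero, Prod.snd_zero, integral_congr_ae h1, integral_congr_ae h2]
    simp
  add_mem' := by
    intro p q hp hq φ h1 h2 h3
    have e1 : (fun x => ((p.1 + q.1 : L2 D) x) • gradient φ x) =ᵐ[volD D]
        fun x => p.1 x • gradient φ x + q.1 x • gradient φ x := by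
      filter_upwards [Lp.coeFn_add p.1 q.1] with x hx
      rw [hx, Pi.add_apply, add_smul]
    have e2 : (fun x => φ x • ((p.2 + q.2 : L2vec D) x)) =ᵐ[volD D]
        fun x => φ x • p.2 x + φ x • q.2 x := by
      filter_upwards [Lp.coeFn_add p.2 q.2] with x hx
      rw [hx, Pi.add_apply, smul_add]
    have hp' := hp φ h1 h2 h3
    have hq' := hq φ h1 h2 h3
    show ∫ x, ((p.1 + q.1 : L2 D) x) • gradient φ x ∂(volD D)
      = - ∫ x, φ x • ((p.2 + q.2 : L2vec D) x) ∂(volD D)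
    rw [integral_congr_ae e1, integral_congr_ae e2,
      integral_add (integrable_smul_gradient _ h1 h2) (integrable_smul_gradient _ h1 h2),
      integral_add (integrable_smul_vec _ h1 h2) (integrable_smul_vec _ h1 h2), hp', hq']
    abel
  smul_mem' := by
    intro c p hp φ h1 h2 h3
    have e1 : (fun x => ((c • p.1 : L2 D) x) • gradient φ x) =ᵐ[volD D]
        fun x => c • (p.1 x • gradient φ x) := by
      filter_upwards [Lp.coeFn_smul c p.1] with x hx
      rw [hx, Pi.smul_apply, smul_assoc]
    have e2 : (fun x => φ x • ((c • p.2 : L2vec D) x)) =ᵐ[volD D]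
        fun x => c • (φ x • p.2 x) := by
      filter_upwards [Lp.coeFn_smul c p.2] with x hx
      rw [hx, Pi.smul_apply, smul_comm]
    have hp' := hp φ h1 h2 h3
    show ∫ x, ((c • p.1 : L2 D) x) • gradient φ x ∂(volD D)
      = - ∫ x, φ x • ((c • p.2 : L2vec D) x) ∂(volD D)
    rw [integral_congr_ae e1, integral_congr_ae e2, integral_smul, integral_smul, hp', smul_neg]

/-- The constant function `1` as an element of `H¹(D)`. -/
def oneH1 : H1 D :=
  ⟨(Lp.const 2 (volD D) (1 : ℝ), 0), by
    intro φ h1 h2 h3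
    have e1 : (fun x => (Lp.const 2 (volD D) (1 : ℝ) x) • gradient φ x) =ᵐ[volD D]
        gradient φ := by
      filter_upwards [Lp.coeFn_const (p := 2) (μ := volD D) (1 : ℝ)] with x hx
      rw [hx]
      simp
    have e2 : (fun x => φ x • ((0 : L2vec D) x)) =ᵐ[volD D] 0 := by
      filter_upwards [Lp.coeFn_zero (E d) 2 (volD D)] with x hx
      rw [hx]
      simp
    show ∫ x, _ ∂(volD D) = - ∫ x, _ ∂(volD D)
    rw [integral_congr_ae e1, integral_congr_ae e2]
    have hz : ∫ x in D.carrier, gradient φ x = ∫ x, gradient φ x := by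
      apply setIntegral_eq_integral_of_forall_compl_eq_zero
      intro x hx
      have : x ∉ tsupport φ := fun h => hx (h3 h)
      have hf : fderiv ℝ φ x = 0 := by
        by_contra hne
        exact this (support_fderiv_subset ℝ hne)
      simp [gradient, hf]
    have hint : Integrable (gradient φ) volume := by
      have hcont : Continuous (gradient φ) := by
        have : Continuous (fderiv ℝ φ) := h1.continuous_fderiv (by simp)
        exact (InnerProductSpace.toDual ℝ (E d)).symm.continuous.comp this
      have hcs : HasCompactSupport (gradient φ) :=
        (h2.fderiv ℝ).comp_left (g := (InnerProductSpace.toDual ℝ (E d)).symm) (map_zero _)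
      exact hcont.integrable_of_hasCompactSupport hcs
    rw [hz]
    simp only [Pi.zero_apply, integral_zero, neg_zero]
    refine ext_inner_left ℝ fun w => ?_
    rw [← integral_inner hint, inner_zero_right]
    have hw : ∀ x, inner ℝ w (gradient φ x) = fderiv ℝ φ x w := by
      intro x
      rw [real_inner_comm, gradient, InnerProductSpace.toDual_symm_apply]
    simp only [hw]
    have := integral_mul_fderiv_eq_neg_fderiv_mul_of_integrable (μ := (volume : Measure (E d)))
      (f := fun _ => (1 : ℝ)) (g := φ) (v := w)
      (by simp) ?_ ?_ (fun x _ => by fun_prop) (fun x _ => h1.differentiable (by simp) x)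
    · simpa using this
    · simpa [hw] using hint.const_inner (𝕜 := ℝ) w
    · simpa using h1.continuous.integrable_of_hasCompactSupport h2⟩

/-! ## The boundary trace -/

/-- The triples `(φ|_D, ∇φ|_D, φ|_{∂D})` for `φ ∈ C^∞(ℝ^d)`. -/
def smoothTriples : Submodule ℝ (L2 D × L2vec D × L2bdry D) where
  carrier := {t | ∃ φ : E d → ℝ, ContDiff ℝ ∞ φ ∧ t.1 =ᵐ[volD D] φ ∧
    t.2.1 =ᵐ[volD D] gradient φ ∧ t.2.2 =ᵐ[surface D] φ}
  zero_mem' := by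
    refine ⟨0, contDiff_const, Lp.coeFn_zero _ _ _, ?_, Lp.coeFn_zero _ _ _⟩
    filter_upwards [Lp.coeFn_zero (E d) 2 (volD D)] with x hx
    simp only [Prod.snd_zero, Prod.fst_zero, hx]
    exact (gradient_const x (0 : ℝ)).symm
  add_mem' := by
    rintro s t ⟨φ, hφ, h1, h2, h3⟩ ⟨ψ, hψ, k1, k2, k3⟩
    refine ⟨φ + ψ, hφ.add hψ, ?_, ?_, ?_⟩
    · filter_upwards [Lp.coeFn_add s.1 t.1, h1, k1] with x hx a b
      exact hx.trans (congrArg₂ (· + ·) a b)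
    · filter_upwards [Lp.coeFn_add s.2.1 t.2.1, h2, k2] with x hx a b
      have e1 := hφ.differentiable (by simp) x
      have e2 := hψ.differentiable (by simp) x
      refine hx.trans ?_
      rw [Pi.add_apply, a, b]
      simp [gradient, fderiv_add e1 e2]
    · filter_upwards [Lp.coeFn_add s.2.2 t.2.2, h3, k3] with x hx a b
      exact hx.trans (congrArg₂ (· + ·) a b)
  smul_mem' := by
    rintro c t ⟨φ, hφ, h1, h2, h3⟩
    refine ⟨c • φ, contDiff_const.smul hφ, ?_, ?_, ?_⟩
    · filter_upwards [Lp.coeFn_smul c t.1, h1] with x hx a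
      exact hx.trans (congrArg (c • ·) a)
    · filter_upwards [Lp.coeFn_smul c t.2.1, h2] with x hx a
      have e1 := hφ.differentiable (by simp) x
      refine hx.trans ?_
      rw [Pi.smul_apply, a]
      simp [gradient, fderiv_const_smul e1 c]
    · filter_upwards [Lp.coeFn_smul c t.2.2, h3] with x hx a
      exact hx.trans (congrArg (c • ·) a)

variable {D} in
/-- `g ∈ L²(∂D)` is a trace of `v ∈ H¹(D)`: there are smooth functions `φ_n` on `ℝ^d` with
`φ_n → v` in `H¹(D)` and `φ_n|_{∂D} → g` in `L²(∂D)`. -/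
def IsTrace (v : H1 D) (g : L2bdry D) : Prop :=
  ((v : L2 D × L2vec D).1, (v : L2 D × L2vec D).2, g) ∈ closure (smoothTriples D : Set _)

theorem exists_linear_selection {X Y : Type*} [AddCommGroup X] [Module ℝ X] [AddCommGroup Y]
    [Module ℝ Y] (Γ : Submodule ℝ (X × Y)) :
    ∃ T : X →ₗ[ℝ] Y, ∀ v, (∃ g, (v, g) ∈ Γ) → (v, T v) ∈ Γ := by
  let π : Γ →ₗ[ℝ] X := LinearMap.fst ℝ X Y ∘ₗ Γ.subtype
  obtain ⟨s, hs⟩ := π.rangeRestrict.exists_rightInverse_of_surjective π.range_rangeRestrict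
  obtain ⟨T, hT⟩ := LinearMap.exists_extend ((LinearMap.snd ℝ X Y ∘ₗ Γ.subtype) ∘ₗ s)
  refine ⟨T, ?_⟩
  rintro v ⟨g, hg⟩
  have hv : v ∈ LinearMap.range π := ⟨⟨(v, g), hg⟩, rfl⟩
  have h1 : T v = (s ⟨v, hv⟩ : X × Y).2 := LinearMap.congr_fun hT ⟨v, hv⟩
  have h2 : (s ⟨v, hv⟩ : X × Y).1 = v := congrArg Subtype.val (LinearMap.congr_fun hs ⟨v, hv⟩)
  have h3 : (s ⟨v, hv⟩ : X × Y) = (v, T v) := Prod.ext h2 h1.symm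
  rw [← h3]
  exact (s ⟨v, hv⟩).2

theorem exists_trace :
    ∃ T : H1 D →ₗ[ℝ] L2bdry D, ∀ v, (∃ g, IsTrace v g) → IsTrace v (T v) := by
  let j : H1 D × L2bdry D →ₗ[ℝ] L2 D × L2vec D × L2bdry D :=
    { toFun := fun p => ((p.1 : L2 D × L2vec D).1, (p.1 : L2 D × L2vec D).2, p.2)
      map_add' := fun _ _ => rfl
      map_smul' := fun _ _ => rfl }
  exact exists_linear_selection ((smoothTriples D).topologicalClosure.comap j)

/-- The trace operator `H¹(D) → L²(∂D)`: a linear map that sends every `v` to a trace of `v`.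
(On a bounded Lipschitz domain every `v` has exactly one trace.) -/
def trace : H1 D →ₗ[ℝ] L2bdry D := (exists_trace D).choose

/-! ## The quotient space `𝓗 = (H¹(D) ⊕ ℝ^M)/ℝ` -/

/-- The line of constants `{(c, (c, …, c)) : c ∈ ℝ}` in `H¹(D) ⊕ ℝ^M`. -/
def constants (M : ℕ) : Submodule ℝ (H1 D × (Fin M → ℝ)) :=
  ℝ ∙ ((oneH1 D, fun _ => 1) : H1 D × (Fin M → ℝ))

end Spaces

section QuotientSpace

variable {d M : ℕ} {D : LipschitzDomain d}

/-- The space `𝓗 = (H¹(D) ⊕ ℝ^M)/ℝ`. It carries the electrodes because its norm does. -/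
def 𝓗 (_El : Electrodes D M) : Type := (H1 D × (Fin M → ℝ)) ⧸ constants D M

variable (El : Electrodes D M)

instance : AddCommGroup (𝓗 El) :=
  inferInstanceAs (AddCommGroup ((H1 D × (Fin M → ℝ)) ⧸ constants D M))

instance : Module ℝ (𝓗 El) :=
  inferInstanceAs (Module ℝ ((H1 D × (Fin M → ℝ)) ⧸ constants D M))

/-- The class of `(v, V)` in `𝓗`. -/
def cls : H1 D × (Fin M → ℝ) →ₗ[ℝ] 𝓗 El := (constants D M).mkQ

/-- The gradient `(v, V) ↦ ∇v ∈ L²(D; ℝ^d)` on `𝓗`. -/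
def grad : 𝓗 El →ₗ[ℝ] L2vec D :=
  (constants D M).liftQ
    (LinearMap.snd ℝ (L2 D) (L2vec D) ∘ₗ (H1 D).subtype ∘ₗ LinearMap.fst ℝ (H1 D) (Fin M → ℝ))
    (by
      unfold constants
      rw [Submodule.span_singleton_le_iff_mem, LinearMap.mem_ker]
      rfl)

/-- The jump `(v, V) ↦ v - V_k` on the boundary, i.e. the trace of `v - V_k ∈ H¹(D)`. -/
def jump (k : Fin M) : 𝓗 El →ₗ[ℝ] L2bdry D :=
  (constants D M).liftQ
    (trace D ∘ₗ (LinearMap.fst ℝ (H1 D) (Fin M → ℝ) -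
      (LinearMap.proj k ∘ₗ LinearMap.snd ℝ (H1 D) (Fin M → ℝ)).smulRight (oneH1 D)))
    (by
      unfold constants
      rw [Submodule.span_singleton_le_iff_mem, LinearMap.mem_ker]
      simp)

theorem grad_cls (p : H1 D × (Fin M → ℝ)) :
    grad El (cls El p) = (p.1 : L2 D × L2vec D).2 := rfl

theorem jump_cls (k : Fin M) (p : H1 D × (Fin M → ℝ)) :
    jump El k (cls El p) = trace D (p.1 - p.2 k • oneH1 D) := rfl

variable {El} in
theorem integrable_grad_inner (p q : 𝓗 El) :
    Integrable (fun x => inner ℝ (grad El p x) (grad El q x)) (volD D) :=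
  L2.integrable_inner _ _

variable {El} in
theorem integrable_jump_mul (k : Fin M) (p q : 𝓗 El) :
    Integrable (fun x => jump El k p x * jump El k q x) ((surface D).restrict (El.set k)) :=
  ((Lp.memLp (jump El k p)).integrable_mul (Lp.memLp (jump El k q))).restrict

/-- The inner product of `𝓗`, which induces the norm
`‖(v,V)‖² = ∫_D |∇v|² dx + ∑_k ∫_{E_k} (v - V_k)² dS`. -/
@[reducible] def innerCore : PreInnerProductSpace.Core ℝ (𝓗 El) where
  inner p q := (∫ x in D.carrier, inner ℝ (grad El p x) (grad El q x)) +
    ∑ k, ∫ x in El.set k, jump El k p x * jump El k q x ∂(surface D)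
  conj_inner_symm p q := by
    rw [conj_trivial]
    congr 1
    · exact integral_congr_ae (ae_of_all _ fun x => real_inner_comm _ _)
    · exact Finset.sum_congr rfl fun k _ =>
        integral_congr_ae (ae_of_all _ fun x => mul_comm _ _)
  re_inner_nonneg p := by
    simp only [RCLike.re_to_real]
    refine add_nonneg (integral_nonneg fun x => real_inner_self_nonneg)
      (Finset.sum_nonneg fun k _ => integral_nonneg fun x => mul_self_nonneg _)
  add_left p q r := by
    have e1 : (fun x => inner ℝ (grad El (p + q) x) (grad El r x)) =ᵐ[volD D]
        fun x => inner ℝ (grad El p x) (grad El r x) + inner ℝ (grad El q x) (grad El r x) := by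
      rw [map_add]
      filter_upwards [Lp.coeFn_add (grad El p) (grad El q)] with x hx
      rw [hx, Pi.add_apply, inner_add_left]
    have e2 : ∀ k, ∫ x in El.set k, jump El k (p + q) x * jump El k r x ∂(surface D) =
        (∫ x in El.set k, jump El k p x * jump El k r x ∂(surface D)) +
          ∫ x in El.set k, jump El k q x * jump El k r x ∂(surface D) := by
      intro k
      rw [← integral_add (integrable_jump_mul k p r) (integrable_jump_mul k q r), map_add]
      refine integral_congr_ae ?_
      filter_upwards [ae_restrict_of_ae (Lp.coeFn_add (jump El k p) (jump El k q))] with x hx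
      rw [hx, Pi.add_apply, add_mul]
    rw [integral_congr_ae e1, integral_add (integrable_grad_inner p r) (integrable_grad_inner q r),
      Finset.sum_congr rfl fun k _ => e2 k, Finset.sum_add_distrib]
    ring
  smul_left p q c := by
    have e1 : (fun x => inner ℝ (grad El (c • p) x) (grad El q x)) =ᵐ[volD D]
        fun x => c * inner ℝ (grad El p x) (grad El q x) := by
      rw [map_smul]
      filter_upwards [Lp.coeFn_smul c (grad El p)] with x hx
      rw [hx, Pi.smul_apply, real_inner_smul_left]
    have e2 : ∀ k, ∫ x in El.set k, jump El k (c • p) x * jump El k q x ∂(surface D) =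
        c * ∫ x in El.set k, jump El k p x * jump El k q x ∂(surface D) := by
      intro k
      rw [← integral_const_mul, map_smul]
      refine integral_congr_ae ?_
      filter_upwards [ae_restrict_of_ae (Lp.coeFn_smul c (jump El k p))] with x hx
      rw [hx, Pi.smul_apply, smul_eq_mul, mul_assoc]
    rw [integral_congr_ae e1, integral_const_mul, Finset.sum_congr rfl fun k _ => e2 k,
      ← Finset.mul_sum, conj_trivial, mul_add]

instance : SeminormedAddCommGroup (𝓗 El) :=
  @InnerProductSpace.Core.toSeminormedAddCommGroup ℝ (𝓗 El) _ _ _ (innerCore El)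

instance : InnerProductSpace ℝ (𝓗 El) := InnerProductSpace.ofCore (innerCore El)

variable {El} in
theorem norm_sq_eq (q : 𝓗 El) :
    ‖q‖ ^ 2 = (∫ x in D.carrier, ‖grad El q x‖ ^ 2) +
      ∑ k, ∫ x in El.set k, (jump El k q x) ^ 2 ∂(surface D) := by
  have h : ‖q‖ ^ 2 = inner ℝ q q := (real_inner_self_eq_norm_sq q).symm
  rw [h]
  simp only [← real_inner_self_eq_norm_sq, pow_two (jump El _ q _)]
  rfl

/-! ## The variational problem -/

variable {El} in
/-- The bilinear form
`B((w,W),(v,V)) = ∫_D a ∇w·∇v dx + ∑_m z_m⁻¹ ∫_{E_m} (w - W_m)(v - V_m) dS`. -/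
def B (a : Linfty D) (z : Fin M → ℝ) (w v : 𝓗 El) : ℝ :=
  (∫ x in D.carrier, a x * inner ℝ (grad El w x) (grad El v x)) +
    ∑ m, (1 / z m) * ∫ x in El.set m, jump El m w x * jump El m v x ∂(surface D)

variable {El} in
/-- `q = (u, U) ∈ 𝓗` is a solution of the complete electrode model with conductivity `a`:
`B((u,U),(v,V)) = ∑_m I_m V_m` for all `(v,V)`. -/
def IsSolution (a : Linfty D) (z I : Fin M → ℝ) (q : 𝓗 El) : Prop :=
  ∀ (v : H1 D) (V : Fin M → ℝ), B a z q (cls El (v, V)) = ∑ m, I m * V m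

variable {El} in
/-- `w ∈ 𝓗` solves `B(w, (v,V)) = - ∫_D b ∇u·∇v dx` for all `(v,V) ∈ 𝓗`. -/
def IsDerivSolution (a b : Linfty D) (z : Fin M → ℝ) (u w : 𝓗 El) : Prop :=
  ∀ v : 𝓗 El, B a z w v = - ∫ x in D.carrier, b x * inner ℝ (grad El u x) (grad El v x)

end QuotientSpace

/-! ## Parametric derivatives -/

/-- The parameter set `Υ = (-1/2, 1/2)^ℕ`. -/
def Υ : Set (ℕ → ℝ) := {y | ∀ j, y j ∈ Ioo (-(1 / 2) : ℝ) (1 / 2)}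

/-- The set `𝓕` of finitely supported multi-indices. -/
abbrev 𝓕 : Type := ℕ →₀ ℕ

/-- `F'` is the partial derivative `∂F/∂y_j` at `y`, in the norm of `X`. -/
def HasPartialDerivAt {X : Type*} [SeminormedAddCommGroup X] [NormedSpace ℝ X]
    (F : (ℕ → ℝ) → X) (F' : X) (j : ℕ) (y : ℕ → ℝ) : Prop :=
  HasDerivAt (fun t : ℝ => F (Function.update y j t)) F' (y j)

/-- `G ν y = ∂_y^ν F(y)` for all `ν ∈ 𝓕` and `y ∈ Υ`: all mixed partial derivatives of `F` exist
on `Υ`, in every order of differentiation, and `G` is the family of them. -/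
def IsMixedDerivs {X : Type*} [SeminormedAddCommGroup X] [NormedSpace ℝ X]
    (F : (ℕ → ℝ) → X) (G : 𝓕 → (ℕ → ℝ) → X) : Prop :=
  (∀ y ∈ Υ, G 0 y = F y) ∧
    ∀ ν, ∀ y ∈ Υ, ∀ j, HasPartialDerivAt (G ν) (G (ν + Finsupp.single j 1) y) j y

end PCEM

end

noncomputable section

namespace PCEM

/-! ## Mixed derivatives of inverse operators -/

section MixedDerivs

/-! By Riesz representation B_y(w,v) = ⟨F(y)w, v⟩ with F(y) = `diffusion` applied to a(y) plus
`contact`, and the currents become a vector f, so the problem reads F(y)u(y) = f. The form is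
coercive in the norm of 𝓗, hence F(y) is invertible (`isUnit_diffusion_add_contact`) and u(y) =
F(y)⁻¹f. As `diffusion` is linear and bounded from L^∞(D) into the operators, F inherits all partial
derivatives from a. The first derivative of u and its variational equation come from ∂_j(F⁻¹) =
-F⁻¹(∂_jF)F⁻¹.

For higher derivatives put α_ν = ∂^νF/ν! and define ψ_ν recursively by ∑_{μ+κ=ν} α_μψ_κ = δ_{ν0}f,
as for the reciprocal of a power series. Induction on ν gives ∂_jψ_ν = (ν_j+1)ψ_{ν+e_j}
(`exists_isMixedDerivs_inverse_apply`). So ν!ψ_ν is ∂^νu; depending on the multi-index alone, it is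
the same for every order of differentiation.

Most of the work shows that 𝓗 is a Hilbert space. Its norm controls only the gradient and the
electrode jumps, so each class needs a representative in H¹(D) ⊕ ℝ^M bounded by that norm
(`exists_representative`). This rests on the Poincaré inequality, the trace inequality and the
positive surface measure of electrodes. The inequalities are proved for smooth functions by moving
points in the direction of the graph charts, and carried to H¹(D) by density of smooth functions,
itself obtained from mollifiers shifted into D. -/

open Finset in
theorem sum_antidiagonal_add_single_fst {H : Type*} [AddCommGroup H] [Module ℝ H]
    (f : 𝓕 → 𝓕 → H) (ν : 𝓕) (j : ℕ) :
    ∑ p ∈ Finset.HasAntidiagonal.antidiagonal (ν + Finsupp.single j 1 : 𝓕), (p.1 j : ℝ) • f p.1 p.2 =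
      ∑ p ∈ Finset.HasAntidiagonal.antidiagonal ν, ((p.1 j : ℝ) + 1) • f (p.1 + Finsupp.single j 1) p.2 := by
  symm
  have h1 : ∑ p ∈ (Finset.HasAntidiagonal.antidiagonal (ν + Finsupp.single j 1 : 𝓕)).filter (fun p => p.1 j ≠ 0),
      (p.1 j : ℝ) • f p.1 p.2 = ∑ p ∈ Finset.HasAntidiagonal.antidiagonal (ν + Finsupp.single j 1 : 𝓕),
        (p.1 j : ℝ) • f p.1 p.2 := by
    apply sum_filter_of_ne
    intro p _ hp h0
    simp [h0] at hp
  rw [← h1]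
  refine sum_nbij' (fun p => (p.1 + Finsupp.single j 1, p.2))
    (fun p => (p.1 - Finsupp.single j 1, p.2)) ?_ ?_ ?_ ?_ ?_
  · intro p hp
    simp only [mem_filter, Finset.HasAntidiagonal.mem_antidiagonal] at hp ⊢
    refine ⟨?_, by simp⟩
    rw [← hp]; abel
  · intro p hp
    simp only [mem_filter, Finset.HasAntidiagonal.mem_antidiagonal] at hp ⊢
    have hle : Finsupp.single j 1 ≤ p.1 := by
      simpa [Finsupp.single_le_iff, Nat.one_le_iff_ne_zero] using hp.2
    have : p.1 - Finsupp.single j 1 + p.2 + Finsupp.single j 1 = ν + Finsupp.single j 1 := by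
      rw [← hp.1, add_right_comm, tsub_add_cancel_of_le hle]
    exact add_right_cancel this
  · intro p hp
    simp
  · intro p hp
    simp only [mem_filter, Finset.HasAntidiagonal.mem_antidiagonal] at hp
    have hle : Finsupp.single j 1 ≤ p.1 := by
      simpa [Finsupp.single_le_iff, Nat.one_le_iff_ne_zero] using hp.2
    simp [tsub_add_cancel_of_le hle]
  · intro p hp
    simp

-- On the antidiagonal of ν + e_j the j-th entries add up to ν_j + 1. Splitting this factor in two,
-- the terms with zero weight drop out and the others shift down by e_j: the Leibniz rule for
-- coefficients normalised by factorials.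
open Finset in
theorem sum_antidiagonal_add_single {H : Type*} [AddCommGroup H] [Module ℝ H]
    (f : 𝓕 → 𝓕 → H) (ν : 𝓕) (j : ℕ) :
    ((ν j : ℝ) + 1) • ∑ p ∈ Finset.HasAntidiagonal.antidiagonal (ν + Finsupp.single j 1 : 𝓕), f p.1 p.2 =
      ∑ p ∈ Finset.HasAntidiagonal.antidiagonal ν, (((p.1 j : ℝ) + 1) • f (p.1 + Finsupp.single j 1) p.2 +
        ((p.2 j : ℝ) + 1) • f p.1 (p.2 + Finsupp.single j 1)) := by
  have h1 := sum_antidiagonal_add_single_fst f ν j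
  have h2 := sum_antidiagonal_add_single_fst (fun a b => f b a) ν j
  rw [Finsupp.sum_antidiagonal_swap _ fun a b => (a j : ℝ) • f b a,
    Finsupp.sum_antidiagonal_swap _ fun a b => ((a j : ℝ) + 1) • f b (a + Finsupp.single j 1)] at h2
  rw [sum_add_distrib, ← h1, ← h2, ← sum_add_distrib, smul_sum]
  refine sum_congr rfl fun p hp => ?_
  rw [← add_smul]
  congr 1
  have := DFunLike.congr_fun (Finset.HasAntidiagonal.mem_antidiagonal.1 hp) j
  simp only [Finsupp.add_apply, Finsupp.single_eq_same] at this
  exact_mod_cast this.symm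

variable {H : Type*} [NormedAddCommGroup H] [NormedSpace ℝ H]

/-- The coefficients `ψ_ν` determined by `∑_{μ+κ=ν} α_μ ψ_κ = δ_{ν0} f`. -/
def inverseCoeff (α : 𝓕 → H →L[ℝ] H) (f : H) (ν : 𝓕) : H :=
  Ring.inverse (α 0) ((if ν = 0 then f else 0) -
    ∑ p ∈ ((Finset.HasAntidiagonal.antidiagonal ν).filter fun p => p.2 < ν).attach,
      α p.1.1 (inverseCoeff α f p.1.2))
termination_by ν
decreasing_by exact (Finset.mem_filter.1 p.2).2

theorem inverseCoeff_eq (α : 𝓕 → H →L[ℝ] H) (f : H) (ν : 𝓕) :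
    inverseCoeff α f ν = Ring.inverse (α 0) ((if ν = 0 then f else 0) -
      ∑ p ∈ (Finset.HasAntidiagonal.antidiagonal ν).filter (fun p => p.2 < ν), α p.1 (inverseCoeff α f p.2)) := by
  rw [inverseCoeff]
  congr 2
  exact Finset.sum_attach ((Finset.HasAntidiagonal.antidiagonal ν).filter fun p => p.2 < ν)
    (fun p => α p.1 (inverseCoeff α f p.2))

/-- Only the pair (0, ν) has a second entry that is not strictly below ν. Splitting it off isolates
the unknown ψ_ν in the recursion. -/
theorem sum_antidiagonal_eq_add_filter_lt {K : Type*} [AddCommGroup K] (g : 𝓕 × 𝓕 → K) (ν : 𝓕) :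
    ∑ p ∈ Finset.HasAntidiagonal.antidiagonal ν, g p =
      g (0, ν) + ∑ p ∈ (Finset.HasAntidiagonal.antidiagonal ν).filter (fun p => p.2 < ν), g p := by
  have h : Finset.HasAntidiagonal.antidiagonal ν =
      insert (0, ν) ((Finset.HasAntidiagonal.antidiagonal ν).filter fun p => p.2 < ν) := by
    ext ⟨a, b⟩
    simp only [Finset.mem_insert, Finset.mem_filter, Finset.HasAntidiagonal.mem_antidiagonal, Prod.mk.injEq]
    constructor
    · intro h
      by_cases ha : a = 0
      · left
        subst ha
        simpa using h
      · right
        refine ⟨h, ?_⟩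
        rw [← h]
        exact lt_add_of_pos_left b (pos_iff_ne_zero.2 ha)
    · rintro (⟨rfl, rfl⟩ | h)
      · simp
      · exact h.1
  conv_lhs => rw [h]
  rw [Finset.sum_insert (by simp)]

theorem sum_inverseCoeff (α : 𝓕 → H →L[ℝ] H) (f : H) (h0 : IsUnit (α 0)) (ν : 𝓕) :
    ∑ p ∈ Finset.HasAntidiagonal.antidiagonal ν, α p.1 (inverseCoeff α f p.2) = if ν = 0 then f else 0 := by
  rw [sum_antidiagonal_eq_add_filter_lt]
  dsimp only
  rw [inverseCoeff_eq α f ν, ← mul_apply_eq_comp, Ring.mul_inverse_cancel _ h0,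
    one_apply_eq_self]
  abel

/-- Υ is not open in the product topology, but it is open along every coordinate line, which is all
that a partial derivative sees. -/
theorem update_mem_Υ {y : ℕ → ℝ} (hy : y ∈ Υ) (j : ℕ) :
    ∀ᶠ t in 𝓝 (y j), Function.update y j t ∈ Υ := by
  filter_upwards [Ioo_mem_nhds (hy j).1 (hy j).2] with t ht k
  by_cases hk : k = j
  · subst hk
    simpa using ht
  · simpa [Function.update_of_ne hk] using hy k

theorem HasPartialDerivAt.inverse [CompleteSpace H] {F : (ℕ → ℝ) → H →L[ℝ] H} {F' : H →L[ℝ] H}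
    {j : ℕ} {y : ℕ → ℝ} (hF : HasPartialDerivAt F F' j y) (hu : IsUnit (F y)) :
    HasPartialDerivAt (fun y => Ring.inverse (F y))
      (-(Ring.inverse (F y) * F' * Ring.inverse (F y))) j y := by
  obtain ⟨x, hx⟩ := hu
  have h := hasFDerivAt_ringInverse (𝕜 := ℝ) x
  unfold HasPartialDerivAt at *
  have hx' : (x : H →L[ℝ] H) = F (Function.update y j (y j)) := by simp [hx]
  rw [hx'] at h
  have := h.comp_hasDerivAt (y j) hF
  simpa [← hx, Function.comp_def, ContinuousLinearMap.mulLeftRight_apply] using this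

/-- The product of the factorials of a multi-index. -/
def multiFactorial (ν : 𝓕) : ℝ := ν.prod fun _ n => (n.factorial : ℝ)

theorem multiFactorial_zero : multiFactorial 0 = 1 := Finsupp.prod_zero_index

theorem multiFactorial_add_single (ν : 𝓕) (j : ℕ) :
    multiFactorial (ν + Finsupp.single j 1) = ((ν j : ℝ) + 1) * multiFactorial ν := by
  classical
  have e1 : multiFactorial (ν + Finsupp.single j 1) =
      ∏ i ∈ insert j ν.support, (((ν + Finsupp.single j 1 : 𝓕) i).factorial : ℝ) := by
    refine Finsupp.prod_of_support_subset _ ?_ _ (by simp)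
    refine Finsupp.support_add.trans ?_
    intro i hi
    rcases Finset.mem_union.1 hi with h | h
    · exact Finset.mem_insert_of_mem h
    · rw [Finset.mem_singleton.1 (Finsupp.support_single_subset h)]
      exact Finset.mem_insert_self _ _
  have e2 : multiFactorial ν = ∏ i ∈ insert j ν.support, ((ν i).factorial : ℝ) :=
    Finsupp.prod_of_support_subset _ (Finset.subset_insert _ _) _ (by simp)
  rw [e1, e2, ← Finset.mul_prod_erase _ _ (Finset.mem_insert_self j _),
    ← Finset.mul_prod_erase _ _ (Finset.mem_insert_self j _)]
  rw [Finset.prod_congr rfl (g := fun i => ((ν i).factorial : ℝ))]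
  · simp only [Finsupp.add_apply, Finsupp.single_eq_same, Nat.factorial_succ]
    push_cast
    ring
  · intro i hi
    rw [Finsupp.add_apply, Finsupp.single_eq_of_ne (Finset.ne_of_mem_erase hi), add_zero]

theorem HasPartialDerivAt.clm_apply {F : (ℕ → ℝ) → H →L[ℝ] H} {F' : H →L[ℝ] H}
    {g : (ℕ → ℝ) → H} {g' : H} {j : ℕ} {y : ℕ → ℝ} (hF : HasPartialDerivAt F F' j y)
    (hg : HasPartialDerivAt g g' j y) :
    HasPartialDerivAt (fun y => F y (g y)) (F' (g y) + F y g') j y := by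
  have := HasDerivAt.clm_apply hF hg
  simpa [HasPartialDerivAt] using this

theorem HasPartialDerivAt.map_clm {X Y : Type*} [NormedAddCommGroup X] [NormedSpace ℝ X]
    [NormedAddCommGroup Y] [NormedSpace ℝ Y] (L : X →L[ℝ] Y) {g : (ℕ → ℝ) → X} {g' : X}
    {j : ℕ} {y : ℕ → ℝ} (hg : HasPartialDerivAt g g' j y) :
    HasPartialDerivAt (fun y => L (g y)) (L g') j y :=
  HasFDerivAt.comp_hasDerivAt (f := fun t => g (Function.update y j t)) (y j) L.hasFDerivAt hg

theorem HasPartialDerivAt.add_const {X : Type*} [NormedAddCommGroup X] [NormedSpace ℝ X]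
    {g : (ℕ → ℝ) → X} {g' : X} {j : ℕ} {y : ℕ → ℝ} (hg : HasPartialDerivAt g g' j y) (c : X) :
    HasPartialDerivAt (fun y => g y + c) g' j y :=
  HasDerivAt.add_const (f := fun t => g (Function.update y j t)) c hg

theorem HasPartialDerivAt.congr_on {X : Type*} [NormedAddCommGroup X] [NormedSpace ℝ X]
    {g g₁ : (ℕ → ℝ) → X} {g' : X} {j : ℕ} {y : ℕ → ℝ} (hg : HasPartialDerivAt g g' j y)
    (hy : y ∈ Υ) (h : ∀ y ∈ Υ, g₁ y = g y) : HasPartialDerivAt g₁ g' j y := by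
  refine HasDerivAt.congr_of_eventuallyEq (f := fun t => g (Function.update y j t)) hg ?_
  filter_upwards [update_mem_Υ hy j] with t ht
  exact h _ ht

/-- If all mixed derivatives of `F` exist and `F y` is invertible, then all mixed derivatives of
`y ↦ F(y)⁻¹ f` exist. -/
theorem exists_isMixedDerivs_inverse_apply [CompleteSpace H] {F : (ℕ → ℝ) → H →L[ℝ] H}
    {dF : 𝓕 → (ℕ → ℝ) → H →L[ℝ] H} (hF : IsMixedDerivs F dF) (hu : ∀ y ∈ Υ, IsUnit (F y))
    (f : H) : ∃ du, IsMixedDerivs (fun y => Ring.inverse (F y) f) du := by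
  -- Division by ν! removes the binomial coefficients from the Leibniz rule, so the equation for the
  -- derivatives becomes a plain convolution identity.
  set α : (ℕ → ℝ) → 𝓕 → H →L[ℝ] H := fun y ν => (multiFactorial ν)⁻¹ • dF ν y with hα
  have hα0 : ∀ y ∈ Υ, α y 0 = F y := fun y hy => by
    simp [hα, multiFactorial_zero, hF.1 y hy]
  have hαd : ∀ ν, ∀ y ∈ Υ, ∀ j, HasPartialDerivAt (fun y => α y ν)
      (((ν j : ℝ) + 1) • α y (ν + Finsupp.single j 1)) j y := by
    intro ν y hy j
    have h := HasDerivAt.const_smul (multiFactorial ν)⁻¹ (hF.2 ν y hy j)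
    have e : ((ν j : ℝ) + 1) • α y (ν + Finsupp.single j 1) =
        (multiFactorial ν)⁻¹ • dF (ν + Finsupp.single j 1) y := by
      have : ((ν j : ℝ) + 1) ≠ 0 := by positivity
      rw [hα]
      dsimp only
      rw [multiFactorial_add_single, smul_smul, mul_inv, mul_inv_cancel_left₀ this]
    rw [e]
    exact h
  have hunit : ∀ y ∈ Υ, IsUnit (α y 0) := fun y hy => by rw [hα0 y hy]; exact hu y hy
  set ψ : (ℕ → ℝ) → 𝓕 → H := fun y => inverseCoeff (α y) f with hψ
  have key : ∀ ν, ∀ y ∈ Υ, ∀ j, HasPartialDerivAt (fun y => ψ y ν)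
      (((ν j : ℝ) + 1) • ψ y (ν + Finsupp.single j 1)) j y := by
    intro ν
    induction ν using WellFoundedLT.induction with
    | ind ν ih =>
    intro y hy j
    have hinv : HasPartialDerivAt (fun y => Ring.inverse (α y 0)) _ j y :=
      (hαd 0 y hy j).inverse (hunit y hy)
    have hsum : HasPartialDerivAt (fun y => (if ν = 0 then f else 0) -
        ∑ p ∈ (Finset.HasAntidiagonal.antidiagonal ν).filter (fun p => p.2 < ν), α y p.1 (ψ y p.2))
        (-∑ p ∈ (Finset.HasAntidiagonal.antidiagonal ν).filter (fun p => p.2 < ν),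
          ((((p.1 j : ℝ) + 1) • α y (p.1 + Finsupp.single j 1)) (ψ y p.2) +
            α y p.1 (((p.2 j : ℝ) + 1) • ψ y (p.2 + Finsupp.single j 1)))) j y := by
      have := HasDerivAt.fun_sum (u := (Finset.HasAntidiagonal.antidiagonal ν).filter (fun p => p.2 < ν))
        (x := y j) fun p hp =>
        (hαd p.1 y hy j).clm_apply (ih p.2 (Finset.mem_filter.1 hp).2 y hy j)
      exact this.const_sub _
    -- The recursion expresses ψ_ν through differentiable terms, so some derivative w exists. Its
    -- explicit form is discarded; the convolution identity identifies it.
    obtain ⟨w, hd⟩ : ∃ w, HasPartialDerivAt (fun y => ψ y ν) w j y := by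
      refine ⟨_, (hinv.clm_apply hsum).congr_of_eventuallyEq (Eventually.of_forall fun t => ?_)⟩
      exact inverseCoeff_eq _ f ν
    -- differentiate the defining identity
    have hall : HasPartialDerivAt
        (fun y => ∑ p ∈ Finset.HasAntidiagonal.antidiagonal ν, α y p.1 (ψ y p.2))
        ((((((0 : 𝓕) j : ℝ) + 1) • α y (0 + Finsupp.single j 1)) (ψ y ν) + α y 0 w) +
          ∑ p ∈ (Finset.HasAntidiagonal.antidiagonal ν).filter (fun p => p.2 < ν),
          ((((p.1 j : ℝ) + 1) • α y (p.1 + Finsupp.single j 1)) (ψ y p.2) +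
            α y p.1 (((p.2 j : ℝ) + 1) • ψ y (p.2 + Finsupp.single j 1)))) j y := by
      have h1 := HasDerivAt.fun_sum (u := (Finset.HasAntidiagonal.antidiagonal ν).filter (fun p => p.2 < ν))
        (x := y j) fun p hp =>
        (hαd p.1 y hy j).clm_apply (ih p.2 (Finset.mem_filter.1 hp).2 y hy j)
      have h2 := HasDerivAt.add ((hαd 0 y hy j).clm_apply hd) h1
      refine h2.congr_of_eventuallyEq (Eventually.of_forall fun t => ?_)
      exact sum_antidiagonal_eq_add_filter_lt
        (fun p => α (Function.update y j t) p.1 (ψ (Function.update y j t) p.2)) ν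
    have hconst : HasPartialDerivAt
        (fun y => ∑ p ∈ Finset.HasAntidiagonal.antidiagonal ν, α y p.1 (ψ y p.2)) 0 j y := by
      refine (hasDerivAt_const (y j) (if ν = 0 then f else 0)).congr_of_eventuallyEq ?_
      filter_upwards [update_mem_Υ hy j] with t ht
      exact sum_inverseCoeff _ f (hunit _ ht) ν
    have hz := HasDerivAt.unique hall hconst
    -- The identity at ν + e_j, multiplied by ν_j + 1, agrees term by term with the differentiated
    -- identity at ν, except that α_0 acts on (ν_j+1)ψ_{ν+e_j} in place of w. Invertibility of α_0
    -- then gives equality.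
    have hform := sum_antidiagonal_add_single (fun a b => α y a (ψ y b)) ν j
    rw [sum_inverseCoeff _ f (hunit y hy), if_neg, smul_zero,
      sum_antidiagonal_eq_add_filter_lt] at hform
    · simp only [smul_apply, map_smul] at hz hform
      have hdiff : α y 0 w = α y 0 (((ν j : ℝ) + 1) • ψ y (ν + Finsupp.single j 1)) := by
        rw [map_smul]
        have := hz.trans hform
        exact add_left_cancel (add_right_cancel this)
      have hinj : w = ((ν j : ℝ) + 1) • ψ y (ν + Finsupp.single j 1) := by
        have h1 : ∀ x, Ring.inverse (α y 0) (α y 0 x) = x := fun x => by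
          change (Ring.inverse (α y 0) * α y 0) x = x
          rw [Ring.inverse_mul_cancel _ (hunit y hy), one_apply_eq_self]
        rw [← h1 w, hdiff, h1]
      rwa [hinj] at hd
    · intro h
      have := DFunLike.congr_fun h j
      simp at this
  refine ⟨fun ν y => multiFactorial ν • ψ y ν, fun y hy => ?_, fun ν y hy j => ?_⟩
  · dsimp only
    rw [multiFactorial_zero, one_smul, hψ]
    dsimp only
    rw [inverseCoeff_eq, hα0 y hy]
    simp
  · have h := HasDerivAt.const_smul (multiFactorial ν) (key ν y hy j)
    dsimp only
    rw [multiFactorial_add_single, mul_comm, ← smul_smul]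
    exact h

end MixedDerivs

/-! ## The Poincaré inequality for smooth functions -/

section Poincare

/-- Cauchy–Schwarz against the constant 1. -/
theorem sq_lintegral_le {α : Type*} [MeasurableSpace α] {μ : Measure α} {f : α → ℝ≥0∞}
    (hf : AEMeasurable f μ) : (∫⁻ x, f x ∂μ) ^ 2 ≤ μ univ * ∫⁻ x, f x ^ 2 ∂μ := by
  have h := ENNReal.lintegral_mul_le_Lp_mul_Lq μ Real.HolderConjugate.two_two
    (aemeasurable_const (b := (1 : ℝ≥0∞))) hf
  simp only [Pi.mul_apply, one_mul, ENNReal.one_rpow, lintegral_one] at h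
  calc (∫⁻ x, f x ∂μ) ^ 2
      ≤ (μ univ ^ (1 / 2 : ℝ) * (∫⁻ x, f x ^ (2 : ℝ) ∂μ) ^ (1 / 2 : ℝ)) ^ 2 := by gcongr
    _ = μ univ * ∫⁻ x, f x ^ 2 ∂μ := by
      rw [mul_pow, ← ENNReal.rpow_natCast, ← ENNReal.rpow_natCast, ← ENNReal.rpow_mul,
        ← ENNReal.rpow_mul]
      norm_num

theorem enorm_add_sq_le {F : Type*} [SeminormedAddCommGroup F] (a b : F) :
    ‖a + b‖ₑ ^ 2 ≤ 2 * ‖a‖ₑ ^ 2 + 2 * ‖b‖ₑ ^ 2 := by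
  have h : ‖a + b‖ ^ 2 ≤ 2 * ‖a‖ ^ 2 + 2 * ‖b‖ ^ 2 := by
    have := norm_add_le a b
    have h0 := norm_nonneg (a + b)
    nlinarith [sq_nonneg (‖a‖ - ‖b‖)]
  simp only [← ofReal_norm, ← ENNReal.ofReal_pow (norm_nonneg _)]
  rw [← ENNReal.ofReal_ofNat 2, ← ENNReal.ofReal_mul zero_le_two, ← ENNReal.ofReal_mul zero_le_two,
    ← ENNReal.ofReal_add (by positivity) (by positivity)]
  exact ENNReal.ofReal_le_ofReal h

variable {d : ℕ}

theorem continuous_gradient {φ : E d → ℝ} (hφ : ContDiff ℝ 1 φ) : Continuous (gradient φ) :=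
  (InnerProductSpace.toDual ℝ (E d)).symm.continuous.comp (hφ.continuous_fderiv (by simp))

theorem enorm_gradient (φ : E d → ℝ) (x : E d) : ‖gradient φ x‖ₑ = ‖fderiv ℝ φ x‖ₑ := by
  rw [gradient, ← ofReal_norm, ← ofReal_norm, LinearIsometryEquiv.norm_map]

/-- The fundamental theorem of calculus along the segment, then Cauchy–Schwarz in s, which produces
the factor t. -/
theorem enorm_sub_sq_le_lintegral_gradient {φ : E d → ℝ} (hφ : ContDiff ℝ 1 φ) (x h : E d)
    {t : ℝ} (ht : 0 ≤ t) :
    ‖φ (x + t • h) - φ x‖ₑ ^ 2 ≤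
      ‖h‖ₑ ^ 2 * ENNReal.ofReal t * ∫⁻ s in Ioc 0 t, ‖gradient φ (x + s • h)‖ₑ ^ 2 := by
  have hd : ∀ s : ℝ, HasDerivAt (fun s : ℝ => φ (x + s • h)) (fderiv ℝ φ (x + s • h) h) s := by
    intro s
    have h1 : HasDerivAt (fun s : ℝ => x + s • h) h s := by
      simpa using ((hasDerivAt_id s).smul_const h).const_add x
    exact ((hφ.differentiable (by simp) _).hasFDerivAt).comp_hasDerivAt s h1
  have hc : Continuous fun s : ℝ => fderiv ℝ φ (x + s • h) :=
    (hφ.continuous_fderiv (by simp)).comp (by fun_prop)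
  have hft := intervalIntegral.integral_eq_sub_of_hasDerivAt (a := 0) (b := t) (fun s _ => hd s)
    ((hc.clm_apply continuous_const).intervalIntegrable _ _)
  simp only [zero_smul, add_zero] at hft
  rw [← hft, intervalIntegral.integral_of_le ht]
  calc ‖∫ s in Ioc 0 t, fderiv ℝ φ (x + s • h) h‖ₑ ^ 2
      ≤ (∫⁻ s in Ioc 0 t, ‖fderiv ℝ φ (x + s • h) h‖ₑ) ^ 2 := by
        gcongr
        exact enorm_integral_le_lintegral_enorm _
    _ ≤ (∫⁻ s in Ioc 0 t, ‖h‖ₑ * ‖gradient φ (x + s • h)‖ₑ) ^ 2 := by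
        gcongr with s
        rw [enorm_gradient, mul_comm]
        exact ContinuousLinearMap.le_opENorm _ _
    _ ≤ volume.restrict (Ioc 0 t) univ *
          ∫⁻ s in Ioc 0 t, (‖h‖ₑ * ‖gradient φ (x + s • h)‖ₑ) ^ 2 := by
        refine sq_lintegral_le (Continuous.aemeasurable ?_)
        exact (ENNReal.continuous_const_mul enorm_ne_top).comp
          ((continuous_gradient hφ).comp (by fun_prop)).enorm
    _ = _ := by
        simp only [mul_pow]
        rw [lintegral_const_mul' _ _ (by simp), Measure.restrict_apply_univ, Real.volume_Ioc,
          sub_zero]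
        ring

theorem lintegral_comp_add_right_restrict_le {f : E d → ℝ≥0∞} {U V : Set (E d)}
    (h : E d) (hUV : ∀ x ∈ U, x + h ∈ V) :
    ∫⁻ x in U, f (x + h) ≤ ∫⁻ x in V, f x := by
  calc ∫⁻ x in U, f (x + h) ≤ ∫⁻ x in (fun x => x + h) ⁻¹' V, f (x + h) :=
        lintegral_mono_set hUV
    _ = ∫⁻ x in V, f x :=
        (measurePreserving_add_right volume h).setLIntegral_comp_preimage_emb
          (measurableEmbedding_addRight h) _ _

/-- If the segments from `x ∈ U` to `x + h` lie in `V`, then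
`‖φ(· + h) - φ‖_{L²(U)} ≤ |h| ‖∇φ‖_{L²(V)}`. -/
theorem lintegral_translation_sub_sq_le {φ : E d → ℝ} (hφ : ContDiff ℝ 1 φ) {U V : Set (E d)}
    (h : E d) (hUV : ∀ x ∈ U, ∀ s ∈ Ioc (0 : ℝ) 1, x + s • h ∈ V) :
    ∫⁻ x in U, ‖φ (x + h) - φ x‖ₑ ^ 2 ≤ ‖h‖ₑ ^ 2 * ∫⁻ x in V, ‖gradient φ x‖ₑ ^ 2 := by
  have hcont := continuous_gradient hφ
  calc ∫⁻ x in U, ‖φ (x + h) - φ x‖ₑ ^ 2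
      ≤ ∫⁻ x in U, ‖h‖ₑ ^ 2 * ∫⁻ s in Ioc (0 : ℝ) 1, ‖gradient φ (x + s • h)‖ₑ ^ 2 := by
        refine lintegral_mono fun x => ?_
        simpa using enorm_sub_sq_le_lintegral_gradient hφ x h zero_le_one
    _ = ‖h‖ₑ ^ 2 * ∫⁻ s in Ioc (0 : ℝ) 1, ∫⁻ x in U, ‖gradient φ (x + s • h)‖ₑ ^ 2 := by
        rw [lintegral_const_mul' _ _ (by simp), lintegral_lintegral_swap]
        refine Continuous.aemeasurable ?_
        exact (ENNReal.continuous_pow 2).comp (hcont.comp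
          (by fun_prop : Continuous fun p : E d × ℝ => p.1 + p.2 • h)).enorm
    _ ≤ ‖h‖ₑ ^ 2 * ∫⁻ _ in Ioc (0 : ℝ) 1, ∫⁻ x in V, ‖gradient φ x‖ₑ ^ 2 := by
        refine mul_le_mul_right ?_ _
        refine setLIntegral_mono' measurableSet_Ioc fun s hs => ?_
        exact lintegral_comp_add_right_restrict_le (f := fun x => ‖gradient φ x‖ₑ ^ 2) (s • h)
          fun x hx => hUV x hx s hs
    _ = _ := by simp

/-- The Poincaré inequality on balls. -/
theorem exists_lintegral_ball_sub_sq_le (x₀ : E d) {r : ℝ} (hr : 0 < r) {V : Set (E d)}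
    (hball : Metric.ball x₀ (3 * r) ⊆ V) :
    ∃ C : NNReal, ∀ φ : E d → ℝ, ContDiff ℝ 1 φ → ∃ c : ℝ,
      ∫⁻ x in Metric.ball x₀ r, ‖φ x - c‖ₑ ^ 2 ≤ C * ∫⁻ x in V, ‖gradient φ x‖ₑ ^ 2 := by
  set U := Metric.ball x₀ r with hU
  set m := (volume : Measure (E d)) U with hm
  have hm0 : m ≠ 0 := (Metric.measure_ball_pos volume x₀ hr).ne'
  have hmt : m ≠ ⊤ := measure_ball_lt_top.ne
  -- T contains all differences of two points of U. A point of U moved by a fraction of a vector of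
  -- T stays within 3r of x₀, whence the radius in the hypothesis on V.
  set T := Metric.ball (0 : E d) (2 * r)
  have hTt : (volume : Measure (E d)) T ≠ ⊤ := measure_ball_lt_top.ne
  set C : ℝ≥0∞ := m⁻¹ * (volume T * ENNReal.ofReal (2 * r) ^ 2) with hC
  have hCt : C ≠ ⊤ := by
    rw [hC]
    exact ENNReal.mul_ne_top (ENNReal.inv_ne_top.2 hm0)
      (ENNReal.mul_ne_top hTt (ENNReal.pow_ne_top ENNReal.ofReal_ne_top))
  refine ⟨C.toNNReal, fun φ hφ => ?_⟩
  rw [ENNReal.coe_toNNReal hCt]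
  set N := ∫⁻ x in V, ‖gradient φ x‖ₑ ^ 2 with hN
  have hφc := hφ.continuous
  -- Substituting x = y + h and exchanging the integrals reduces the double integral to translation
  -- differences, each bounded by the gradient.
  have hdouble : ∫⁻ y in U, ∫⁻ x in U, ‖φ x - φ y‖ₑ ^ 2 ≤
      volume T * ENNReal.ofReal (2 * r) ^ 2 * N := by
    calc ∫⁻ y in U, ∫⁻ x in U, ‖φ x - φ y‖ₑ ^ 2
        ≤ ∫⁻ y in U, ∫⁻ h in T, ‖φ (y + h) - φ y‖ₑ ^ 2 := by
          refine setLIntegral_mono' Metric.isOpen_ball.measurableSet fun y hy => ?_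
          have := lintegral_comp_add_right_restrict_le
            (f := fun h => ‖φ (y + h) - φ y‖ₑ ^ 2) (U := U) (V := T)
            (-y) (fun x hx => by
              rw [mem_ball_zero_iff, ← sub_eq_add_neg]
              rw [hU, Metric.mem_ball] at hx hy
              rw [← dist_eq_norm]
              linarith [dist_triangle_right x y x₀])
          simpa using this
      _ = ∫⁻ h in T, ∫⁻ y in U, ‖φ (y + h) - φ y‖ₑ ^ 2 := by
          refine lintegral_lintegral_swap (Continuous.aemeasurable ?_)
          exact (ENNReal.continuous_pow 2).comp ((hφc.comp
            (by fun_prop : Continuous fun p : E d × E d => p.1 + p.2)).sub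
            (hφc.comp continuous_fst)).enorm
      _ ≤ ∫⁻ _ in T, ENNReal.ofReal (2 * r) ^ 2 * N := by
          refine setLIntegral_mono' Metric.isOpen_ball.measurableSet fun h hh => ?_
          refine (lintegral_translation_sub_sq_le hφ h fun x hx s hs => hball ?_).trans ?_
          · rw [mem_ball_zero_iff] at hh
            rw [hU, mem_ball_iff_norm] at hx
            rw [mem_ball_iff_norm]
            have h1 : ‖s • h‖ ≤ ‖h‖ := by
              rw [norm_smul, Real.norm_eq_abs, abs_of_pos hs.1]
              nlinarith [norm_nonneg h, hs.2]
            calc ‖x + s • h - x₀‖ = ‖(x - x₀) + s • h‖ := by congr 1; abel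
              _ ≤ ‖x - x₀‖ + ‖s • h‖ := norm_add_le _ _
              _ < 3 * r := by linarith
          · gcongr
            rw [mem_ball_zero_iff] at hh
            rw [← ofReal_norm]
            exact ENNReal.ofReal_le_ofReal hh.le
      _ = _ := by
          rw [setLIntegral_const]
          ring
  have hmeas : AEMeasurable (fun y => ∫⁻ x in U, ‖φ x - φ y‖ₑ ^ 2) (volume.restrict U) := by
    refine Measurable.aemeasurable ?_
    refine Measurable.lintegral_prod_right' (f := fun p : E d × E d => ‖φ p.2 - φ p.1‖ₑ ^ 2) ?_
    exact ((ENNReal.continuous_pow 2).comp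
      ((hφc.comp continuous_snd).sub (hφc.comp continuous_fst)).enorm).measurable
  -- Some y in U has inner integral at most its average over U; the value φ y serves as the
  -- constant.
  obtain ⟨y, -, hy⟩ := exists_le_setLAverage hm0 hmt hmeas
  refine ⟨φ y, hy.trans ?_⟩
  rw [setLAverage_eq, ENNReal.div_eq_inv_mul, hC, mul_assoc]
  gcongr

end Poincare

/-! ### Lipschitz graph charts and the height above the graph -/

section Charts

variable {d : ℕ}

/-- A chart in which `D` is the part of a ball strictly above a Lipschitz graph. -/
structure GraphChart (D : LipschitzDomain d) (x₀ : E d) where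
  e : E d
  r : ℝ
  K : NNReal
  γ : (ℝ ∙ e)ᗮ → ℝ
  norm_e : ‖e‖ = 1
  r_pos : 0 < r
  lipschitz : LipschitzWith K γ
  mem_iff : ∀ x ∈ Metric.ball x₀ r,
    (x ∈ D.carrier ↔ γ ((ℝ ∙ e)ᗮ.orthogonalProjectionOnto x) < inner ℝ e x)

theorem LipschitzDomain.exists_graphChart (D : LipschitzDomain d) {x₀ : E d}
    (hx₀ : x₀ ∈ frontier D.carrier) : Nonempty (GraphChart D x₀) := by
  obtain ⟨e, r, K, γ, h1, h2, h3, h4⟩ := D.lipschitz x₀ hx₀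
  exact ⟨⟨e, r, K, γ, h1, h2, h3, h4⟩⟩

namespace GraphChart

variable {D : LipschitzDomain d} {x₀ : E d} (c : GraphChart D x₀)

/-- The projection onto the base hyperplane. -/
abbrev proj : E d →L[ℝ] (ℝ ∙ c.e)ᗮ := (ℝ ∙ c.e)ᗮ.orthogonalProjectionOnto

/-- The height above the graph. -/
def height (x : E d) : ℝ := inner ℝ c.e x - c.γ (c.proj x)

theorem continuous_height : Continuous c.height :=
  (continuous_const.inner continuous_id).sub (c.lipschitz.continuous.comp c.proj.continuous)

theorem mem_iff_height_pos {x : E d} (hx : x ∈ Metric.ball x₀ c.r) :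
    x ∈ D.carrier ↔ 0 < c.height x := by
  rw [c.mem_iff x hx, height, sub_pos]

theorem proj_e : c.proj c.e = 0 := by
  rw [Submodule.orthogonalProjectionOnto_eq_zero_iff, Submodule.orthogonal_orthogonal]
  exact Submodule.mem_span_singleton_self _

theorem proj_add_smul (x : E d) (t : ℝ) : c.proj (x + t • c.e) = c.proj x := by
  rw [map_add, map_smul, c.proj_e, smul_zero, add_zero]

theorem inner_e_e : inner ℝ c.e c.e = (1 : ℝ) := by
  rw [real_inner_self_eq_norm_sq, c.norm_e, one_pow]

theorem height_add_smul (x : E d) (t : ℝ) : c.height (x + t • c.e) = c.height x + t := by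
  rw [height, height, c.proj_add_smul, inner_add_right, inner_smul_right, c.inner_e_e]
  ring

theorem norm_smul_e {t : ℝ} (ht : 0 ≤ t) : ‖t • c.e‖ = t := by
  rw [norm_smul, c.norm_e, mul_one, Real.norm_of_nonneg ht]

theorem abs_height_sub_le (x y : E d) : |c.height x - c.height y| ≤ (1 + c.K) * ‖x - y‖ := by
  have h1 : |inner ℝ c.e (x - y)| ≤ ‖x - y‖ := by
    simpa [c.norm_e] using abs_real_inner_le_norm c.e (x - y)
  have h2 : |c.γ (c.proj x) - c.γ (c.proj y)| ≤ c.K * ‖x - y‖ := by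
    have h := c.lipschitz.dist_le_mul (c.proj x) (c.proj y)
    rw [Real.dist_eq, dist_eq_norm, ← map_sub] at h
    refine h.trans ?_
    gcongr
    exact Submodule.norm_orthogonalProjectionOnto_apply_le _ _
  have e : c.height x - c.height y =
      inner ℝ c.e (x - y) - (c.γ (c.proj x) - c.γ (c.proj y)) := by
    rw [height, height, inner_sub_right]
    ring
  rw [e]
  refine (abs_sub _ _).trans ?_
  linarith

theorem height_nonneg {x : E d} (hx : x ∈ Metric.ball x₀ c.r) (hD : x ∈ closure D.carrier) :
    0 ≤ c.height x := by
  by_contra! h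
  have hn : Metric.ball x₀ c.r ∩ {y | c.height y < 0} ∈ 𝓝 x :=
    inter_mem (Metric.isOpen_ball.mem_nhds hx)
      ((isOpen_lt c.continuous_height continuous_const).mem_nhds h)
  obtain ⟨y, ⟨hy1, hy2⟩, hy3⟩ := mem_closure_iff_nhds.1 hD _ hn
  exact absurd ((c.mem_iff_height_pos hy1).1 hy3) (not_lt.2 (le_of_lt hy2))

/-- The height is nonnegative on the closure by continuity. If it were positive, x would lie in the
open set D, which is disjoint from its frontier. -/
theorem height_eq_zero {x : E d} (hx : x ∈ Metric.ball x₀ c.r) (hD : x ∈ frontier D.carrier) :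
    c.height x = 0 := by
  refine le_antisymm ?_ (c.height_nonneg hx hD.1)
  by_contra! h
  have : x ∈ D.carrier := (c.mem_iff_height_pos hx).2 h
  rw [D.isOpen.frontier_eq] at hD
  exact hD.2 this

theorem add_smul_mem_ball {x : E d} {ρ t : ℝ} (hx : x ∈ Metric.ball x₀ ρ) (ht : 0 ≤ t)
    (h : ρ + t ≤ c.r) : x + t • c.e ∈ Metric.ball x₀ c.r := by
  rw [mem_ball_iff_norm] at hx ⊢
  have h1 := norm_add_le (x - x₀) (t • c.e)
  rw [c.norm_smul_e ht] at h1
  have e : x + t • c.e - x₀ = x - x₀ + t • c.e := by abel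
  rw [e]
  linarith

/-- A shift by t in the direction e raises the height by exactly t, so points of the closure enter
D. The Poincaré inequality at the boundary and the collar estimate both rest on this. -/
theorem add_smul_mem {x : E d} {ρ t : ℝ} (hx : x ∈ Metric.ball x₀ ρ)
    (hD : x ∈ closure D.carrier) (ht : 0 < t) (h : ρ + t ≤ c.r) : x + t • c.e ∈ D.carrier := by
  have hb : x ∈ Metric.ball x₀ c.r := Metric.ball_subset_ball (by linarith) hx
  rw [c.mem_iff_height_pos (c.add_smul_mem_ball hx ht.le h), c.height_add_smul]
  linarith [c.height_nonneg hb hD]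

end GraphChart

end Charts

/-! ### From local to global Poincaré inequality -/

section GlobalPoincare

variable {d : ℕ}

theorem lintegral_sub_sq_le {φ : E d → ℝ} (hφ : Continuous φ) (S : Set (E d)) (a b : ℝ) :
    ∫⁻ x in S, ‖φ x - b‖ₑ ^ 2 ≤
      2 * (∫⁻ x in S, ‖φ x - a‖ₑ ^ 2) + 2 * (‖a - b‖ₑ ^ 2 * volume S) := by
  have hm : Measurable fun x => ‖φ x - a‖ₑ ^ 2 :=
    ((ENNReal.continuous_pow 2).comp (hφ.sub continuous_const).enorm).measurable
  calc ∫⁻ x in S, ‖φ x - b‖ₑ ^ 2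
      ≤ ∫⁻ x in S, (2 * ‖φ x - a‖ₑ ^ 2 + 2 * ‖a - b‖ₑ ^ 2) := by
        refine lintegral_mono fun x => ?_
        have := enorm_add_sq_le (φ x - a) (a - b)
        rwa [sub_add_sub_cancel] at this
    _ = _ := by
        rw [lintegral_add_left (hm.const_mul 2), lintegral_const_mul _ hm, setLIntegral_const]
        ring

/-- Comparison of the deviations from two constants. -/
theorem exists_lintegral_sub_sq_le_of_overlap {S W : Set (E d)} (hWS : W ⊆ S)
    (hW : volume W ≠ 0) (hS : volume S ≠ ⊤) (A A' : NNReal) :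
    ∃ C : NNReal, ∀ φ : E d → ℝ, Continuous φ → ∀ (a b : ℝ) (N : ℝ≥0∞),
      ∫⁻ x in S, ‖φ x - a‖ₑ ^ 2 ≤ A * N → ∫⁻ x in W, ‖φ x - b‖ₑ ^ 2 ≤ A' * N →
        ∫⁻ x in S, ‖φ x - b‖ₑ ^ 2 ≤ C * N := by
  have hWt : volume W ≠ ⊤ := ne_top_of_le_ne_top hS (measure_mono hWS)
  set C : ℝ≥0∞ := 2 * A + 2 * (((volume W)⁻¹ * (2 * A' + 2 * A)) * volume S) with hC
  have hCt : C ≠ ⊤ := by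
    rw [hC]
    have h1 : (volume W)⁻¹ ≠ ⊤ := ENNReal.inv_ne_top.2 hW
    finiteness
  refine ⟨C.toNNReal, fun φ hφ a b N ha hb => ?_⟩
  rw [ENNReal.coe_toNNReal hCt]
  have hm : Measurable fun x => ‖φ x - b‖ₑ ^ 2 :=
    ((ENNReal.continuous_pow 2).comp (hφ.sub continuous_const).enorm).measurable
  -- On the overlap W both deviations are controlled, and W has positive measure, so the distance of
  -- the two constants is controlled as well.
  have h1 : ‖a - b‖ₑ ^ 2 * volume W ≤ (2 * A' + 2 * A) * N := by
    calc ‖a - b‖ₑ ^ 2 * volume W = ∫⁻ _ in W, ‖a - b‖ₑ ^ 2 := by rw [setLIntegral_const]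
      _ ≤ ∫⁻ x in W, (2 * ‖φ x - b‖ₑ ^ 2 + 2 * ‖φ x - a‖ₑ ^ 2) := by
          refine lintegral_mono fun x => ?_
          have := enorm_add_sq_le (φ x - b) (a - φ x)
          rwa [sub_add_sub_cancel', ← neg_sub (φ x) a, enorm_neg] at this
      _ = 2 * (∫⁻ x in W, ‖φ x - b‖ₑ ^ 2) + 2 * ∫⁻ x in W, ‖φ x - a‖ₑ ^ 2 := by
          rw [lintegral_add_left (hm.const_mul 2), lintegral_const_mul _ hm,
            lintegral_const_mul' _ _ (by simp)]
      _ ≤ 2 * (A' * N) + 2 * (A * N) := by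
          gcongr
          exact (lintegral_mono_set hWS).trans ha
      _ = _ := by ring
  have h2 : ‖a - b‖ₑ ^ 2 ≤ (volume W)⁻¹ * ((2 * A' + 2 * A) * N) := by
    rw [← ENNReal.div_eq_inv_mul, ENNReal.le_div_iff_mul_le (Or.inl hW) (Or.inl hWt)]
    exact h1
  calc ∫⁻ x in S, ‖φ x - b‖ₑ ^ 2
      ≤ 2 * (∫⁻ x in S, ‖φ x - a‖ₑ ^ 2) + 2 * (‖a - b‖ₑ ^ 2 * volume S) :=
        lintegral_sub_sq_le hφ S a b
    _ ≤ 2 * (A * N) + 2 * ((volume W)⁻¹ * ((2 * A' + 2 * A) * N) * volume S) := by gcongr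
    _ = C * N := by rw [hC]; ring

/-- The Poincaré inequality on a bounded Lipschitz domain, for smooth functions. -/
theorem exists_lintegral_sub_sq_le_gradient (D : LipschitzDomain d) :
    ∃ C : NNReal, ∀ φ : E d → ℝ, ContDiff ℝ 1 φ → ∃ c : ℝ,
      ∫⁻ x in D.carrier, ‖φ x - c‖ₑ ^ 2 ≤ C * ∫⁻ x in D.carrier, ‖gradient φ x‖ₑ ^ 2 := by
  have hDm := D.isOpen.measurableSet
  have hball : ∀ x ∈ D.carrier, ∃ r > 0, Metric.ball x (3 * r) ⊆ D.carrier := by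
    intro x hx
    obtain ⟨ε, hε, h⟩ := Metric.isOpen_iff.1 D.isOpen x hx
    exact ⟨ε / 3, by positivity, by convert h using 2; ring⟩
  obtain ⟨x₁, hx₁⟩ := D.isConnected.nonempty
  obtain ⟨r₁, hr₁, hb₁⟩ := hball x₁ hx₁
  obtain ⟨C₁, hC₁⟩ := exists_lintegral_ball_sub_sq_le x₁ hr₁ hb₁
  -- One ball fixes the constant for each φ. Every other local estimate is moved to this same
  -- constant, so that finitely many of them can be added.
  choose! c₀ hc₀ using hC₁
  set P : Set (E d) → Prop := fun S => ∃ C : NNReal, ∀ φ : E d → ℝ, ContDiff ℝ 1 φ →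
      ∫⁻ x in S ∩ D.carrier, ‖φ x - c₀ φ‖ₑ ^ 2 ≤
        C * ∫⁻ x in D.carrier, ‖gradient φ x‖ₑ ^ 2 with hP
  have hmono : ∀ ⦃s t : Set (E d)⦄, s ⊆ t → P t → P s := fun s t hst ⟨C, hC⟩ =>
    ⟨C, fun φ hφ => (lintegral_mono_set (inter_subset_inter_left _ hst)).trans (hC φ hφ)⟩
  have hunion : ∀ ⦃s t : Set (E d)⦄, P s → P t → P (s ∪ t) := fun s t ⟨C, hC⟩ ⟨C', hC'⟩ =>
    ⟨C + C', fun φ hφ => by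
      rw [union_inter_distrib_right, ENNReal.coe_add, add_mul]
      exact (lintegral_union_le _ _ _).trans (add_le_add (hC φ hφ) (hC' φ hφ))⟩
  -- interior points
  set G : Set (E d) := {x | ∃ U ∈ 𝓝 x, P U} with hG
  have hGo : IsOpen G := by
    rw [isOpen_iff_mem_nhds]
    rintro x ⟨U, hU, hPU⟩
    filter_upwards [eventually_mem_nhds_iff.2 hU] with y hy
    exact ⟨U, hy, hPU⟩
  -- Connectedness: G is open and meets D, and a limit point of G in D lies in G, because a small
  -- ball around it overlaps a good neighbourhood in positive measure.
  have hint : D.carrier ⊆ G := by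
    refine D.isConnected.isPreconnected.subset_of_closure_inter_subset hGo ⟨x₁, hx₁, ?_⟩ ?_
    · exact ⟨_, Metric.ball_mem_nhds x₁ hr₁, C₁, fun φ hφ =>
        (lintegral_mono_set inter_subset_left).trans (hc₀ φ hφ)⟩
    · rintro x ⟨hxG, hxD⟩
      obtain ⟨r, hr, hb⟩ := hball x hxD
      obtain ⟨A, hA⟩ := exists_lintegral_ball_sub_sq_le x hr hb
      obtain ⟨x', hx'b, U, hU, A', hA'⟩ :=
        mem_closure_iff_nhds.1 hxG _ (Metric.ball_mem_nhds x hr)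
      have hbD : Metric.ball x r ⊆ D.carrier :=
        (Metric.ball_subset_ball (by linarith)).trans hb
      have hW : volume (U ∩ Metric.ball x r) ≠ 0 :=
        (Measure.measure_pos_of_mem_nhds volume
          (inter_mem hU (Metric.isOpen_ball.mem_nhds hx'b))).ne'
      obtain ⟨C, hC⟩ := exists_lintegral_sub_sq_le_of_overlap inter_subset_right hW
        measure_ball_lt_top.ne A A'
      refine ⟨_, Metric.ball_mem_nhds x hr, C, fun φ hφ => ?_⟩
      obtain ⟨a, ha⟩ := hA φ hφ
      refine (lintegral_mono_set inter_subset_left).trans (hC φ hφ.continuous a _ _ ha ?_)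
      exact (lintegral_mono_set (inter_subset_inter_right _ hbD)).trans (hA' φ hφ)
  -- boundary points
  have hbdry : frontier D.carrier ⊆ G := by
    intro x₀ hx₀
    obtain ⟨c⟩ := D.exists_graphChart hx₀
    have hr := c.r_pos
    -- The shift by h carries x₀ to an interior point, where the estimate is known. Near x₀ one
    -- writes φ(x) - c₀ as (φ(x) - φ(x+h)) + (φ(x+h) - c₀); the first part is a translation
    -- difference along segments inside D.
    set h : E d := (c.r / 2) • c.e with hh
    have hmem : x₀ + h ∈ D.carrier :=
      c.add_smul_mem (ρ := c.r / 2) (Metric.mem_ball_self (by positivity)) hx₀.1 (by positivity)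
        (by linarith)
    obtain ⟨U, hU, A, hA⟩ := hint hmem
    have hpre : (fun x => x + h) ⁻¹' U ∈ 𝓝 x₀ :=
      (continuous_id.add continuous_const).continuousAt.preimage_mem_nhds hU
    set S := Metric.ball x₀ (c.r / 2) ∩ (fun x => x + h) ⁻¹' U with hS
    refine ⟨S, inter_mem (Metric.ball_mem_nhds x₀ (by positivity)) hpre,
      2 * ‖h‖₊ ^ 2 + 2 * A, fun φ hφ => ?_⟩
    have hseg : ∀ x ∈ S ∩ D.carrier, ∀ s ∈ Ioc (0 : ℝ) 1, x + s • h ∈ D.carrier := by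
      intro x hx s hs
      rw [hh, smul_smul]
      refine c.add_smul_mem hx.1.1 (subset_closure hx.2) (mul_pos hs.1 (by positivity)) ?_
      nlinarith [hs.2]
    have h1 := lintegral_translation_sub_sq_le hφ h hseg
    have h2 : ∫⁻ x in S ∩ D.carrier, ‖φ (x + h) - c₀ φ‖ₑ ^ 2 ≤
        A * ∫⁻ x in D.carrier, ‖gradient φ x‖ₑ ^ 2 := by
      refine (lintegral_comp_add_right_restrict_le (f := fun x => ‖φ x - c₀ φ‖ₑ ^ 2) h
        (V := U ∩ D.carrier) fun x hx => ⟨hx.1.2, ?_⟩).trans (hA φ hφ)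
      simpa using hseg x hx 1 ⟨zero_lt_one, le_rfl⟩
    have hm : Measurable fun x => ‖φ (x + h) - φ x‖ₑ ^ 2 := by
      have := hφ.continuous
      exact ((ENNReal.continuous_pow 2).comp (Continuous.enorm (by fun_prop))).measurable
    calc ∫⁻ x in S ∩ D.carrier, ‖φ x - c₀ φ‖ₑ ^ 2
        ≤ ∫⁻ x in S ∩ D.carrier, (2 * ‖φ (x + h) - φ x‖ₑ ^ 2 +
            2 * ‖φ (x + h) - c₀ φ‖ₑ ^ 2) := by
          refine lintegral_mono fun x => ?_
          have := enorm_add_sq_le (φ x - φ (x + h)) (φ (x + h) - c₀ φ)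
          rwa [sub_add_sub_cancel, ← neg_sub (φ (x + h)) (φ x), enorm_neg] at this
      _ = 2 * (∫⁻ x in S ∩ D.carrier, ‖φ (x + h) - φ x‖ₑ ^ 2) +
            2 * ∫⁻ x in S ∩ D.carrier, ‖φ (x + h) - c₀ φ‖ₑ ^ 2 := by
          rw [lintegral_add_left (hm.const_mul 2), lintegral_const_mul _ hm,
            lintegral_const_mul' _ _ (by simp)]
      _ ≤ 2 * (‖h‖ₑ ^ 2 * ∫⁻ x in D.carrier, ‖gradient φ x‖ₑ ^ 2) +
            2 * (A * ∫⁻ x in D.carrier, ‖gradient φ x‖ₑ ^ 2) := by gcongr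
      _ = _ := by
          push_cast
          rw [enorm_eq_nnnorm]
          ring
  have hcompact : IsCompact (closure D.carrier) := D.isBounded.isCompact_closure
  have hfin : P (closure D.carrier) := by
    refine hcompact.induction_on ⟨0, fun φ _ => by simp⟩ hmono hunion fun x hx => ?_
    have hxG : x ∈ G := by
      rw [closure_eq_self_union_frontier] at hx
      exact hx.elim (fun h => hint h) fun h => hbdry h
    obtain ⟨U, hU, hPU⟩ := hxG
    exact ⟨U, mem_nhdsWithin_of_mem_nhds hU, hPU⟩
  obtain ⟨C, hC⟩ := hfin
  refine ⟨C, fun φ hφ => ⟨c₀ φ, ?_⟩⟩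
  have := hC φ hφ
  rwa [inter_eq_right.2 subset_closure] at this

end GlobalPoincare

/-! ## The trace inequality for smooth functions -/

section Trace

variable {d : ℕ}

/-- Integration over `ℝ^d` along lines in the direction `e`. -/
theorem exists_lintegral_orthogonal_lintegral_eq {e : E d} (he : ‖e‖ = 1) :
    ∃ c : NNReal, ∀ f : E d → ℝ≥0∞, Measurable f →
      ∫⁻ w : (ℝ ∙ e)ᗮ, ∫⁻ t : ℝ, f (w + t • e) = c * ∫⁻ x, f x := by
  have hee : inner ℝ e e = (1 : ℝ) := by rw [real_inner_self_eq_norm_sq, he, one_pow]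
  have hw : ∀ w : (ℝ ∙ e)ᗮ, inner ℝ e (w : E d) = (0 : ℝ) := fun w =>
    Submodule.mem_orthogonal_singleton_iff_inner_right.1 w.2
  let L₀ : (ℝ ∙ e)ᗮ × ℝ →ₗ[ℝ] E d :=
    (ℝ ∙ e)ᗮ.subtype.coprod (LinearMap.toSpanSingleton ℝ (E d) e)
  have hL₀ : ∀ p, L₀ p = p.1 + p.2 • e := fun p => by
    simp [L₀, LinearMap.coprod_apply]
  have hbij : Function.Bijective L₀ := by
    constructor
    · rw [injective_iff_map_eq_zero]
      intro p hp
      rw [hL₀] at hp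
      have h2 : p.2 = 0 := by
        have := congrArg (inner ℝ e) hp
        rwa [inner_add_right, inner_smul_right, hw, hee, inner_zero_right, zero_add,
          mul_one] at this
      rw [h2, zero_smul, add_zero] at hp
      exact Prod.ext (Subtype.ext hp) h2
    · intro x
      refine ⟨(⟨x - inner ℝ e x • e, ?_⟩, inner ℝ e x), ?_⟩
      · rw [Submodule.mem_orthogonal_singleton_iff_inner_right]
        simp [inner_sub_right, inner_smul_right, he]
      · rw [hL₀]
        simp
  let L : ((ℝ ∙ e)ᗮ × ℝ) ≃L[ℝ] E d := (LinearEquiv.ofBijective L₀ hbij).toContinuousLinearEquiv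
  have hL : ∀ p, L p = p.1 + p.2 • e := hL₀
  set μ : Measure ((ℝ ∙ e)ᗮ × ℝ) := (volume : Measure (ℝ ∙ e)ᗮ).prod (volume : Measure ℝ)
  -- The push-forward of the product measure is a Haar measure, hence a finite multiple of Lebesgue
  -- measure. The value of the factor is not needed.
  have hμ : (μ.map L).IsAddHaarMeasure := L.isAddHaarMeasure_map μ
  refine ⟨(μ.map L).addHaarScalarFactor volume, fun f hf => ?_⟩
  have h1 := Measure.isAddLeftInvariant_eq_smul (μ.map L) (volume : Measure (E d))
  have h2 : ∫⁻ x, f x ∂(μ.map L) = ∫⁻ w : (ℝ ∙ e)ᗮ, ∫⁻ t : ℝ, f (w + t • e) := by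
    rw [lintegral_map hf L.continuous.measurable, lintegral_prod]
    · simp only [hL]
    · exact (hf.comp L.continuous.measurable).aemeasurable
  rw [← h2]
  conv_lhs => rw [h1]
  rw [lintegral_smul_measure]
  rfl

namespace GraphChart

variable {D : LipschitzDomain d} {x₀ : E d} (c : GraphChart D x₀)

/-- The parametrisation of the graph by the base hyperplane. -/
def graphMap (w : (ℝ ∙ c.e)ᗮ) : E d := w + c.γ w • c.e

theorem lipschitz_graphMap : LipschitzWith (1 + c.K) c.graphMap := by
  have h2 : LipschitzWith c.K fun w => c.γ w • c.e := by
    refine LipschitzWith.of_dist_le_mul fun x y => ?_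
    rw [dist_eq_norm, ← sub_smul, norm_smul, c.norm_e, mul_one]
    exact c.lipschitz.dist_le_mul x y
  exact LipschitzWith.subtype_val _ |>.add h2

theorem proj_coe (w : (ℝ ∙ c.e)ᗮ) : c.proj (w : E d) = w :=
  Submodule.orthogonalProjectionOnto_mem_subspace_eq_self w

theorem inner_e_coe (w : (ℝ ∙ c.e)ᗮ) : inner ℝ c.e (w : E d) = (0 : ℝ) :=
  Submodule.mem_orthogonal_singleton_iff_inner_right.1 w.2

theorem proj_graphMap (w : (ℝ ∙ c.e)ᗮ) : c.proj (c.graphMap w) = w := by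
  rw [graphMap, c.proj_add_smul, c.proj_coe]

theorem height_graphMap (w : (ℝ ∙ c.e)ᗮ) : c.height (c.graphMap w) = 0 := by
  rw [graphMap, c.height_add_smul, height, c.proj_coe, c.inner_e_coe]
  ring

theorem coe_proj_add (x : E d) : (c.proj x : E d) + inner ℝ c.e x • c.e = x := by
  have hm : x - inner ℝ c.e x • c.e ∈ (ℝ ∙ c.e)ᗮ := by
    rw [Submodule.mem_orthogonal_singleton_iff_inner_right]
    simp [inner_sub_right, inner_smul_right, c.norm_e]
  have h1 := c.proj_coe ⟨_, hm⟩
  have h2 : c.proj (x - inner ℝ c.e x • c.e) = c.proj x := by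
    rw [sub_eq_add_neg, ← neg_smul, c.proj_add_smul]
  rw [h2] at h1
  rw [h1]
  simp

theorem graphMap_proj {x : E d} (hx : c.height x = 0) : c.graphMap (c.proj x) = x := by
  conv_rhs => rw [← c.coe_proj_add x]
  rw [graphMap, sub_eq_zero.1 hx]

/-- A graph point has height zero, so it is not in D; it is the limit of the points just above it,
which are. -/
theorem graphMap_mem_frontier {w : (ℝ ∙ c.e)ᗮ} (hw : c.graphMap w ∈ Metric.ball x₀ c.r) :
    c.graphMap w ∈ frontier D.carrier := by
  rw [D.isOpen.frontier_eq]
  refine ⟨?_, fun h => ?_⟩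
  · have hcont : Tendsto (fun t : ℝ => c.graphMap w + t • c.e) (𝓝[>] 0)
        (𝓝 (c.graphMap w)) := by
      have : Continuous fun t : ℝ => c.graphMap w + t • c.e := by fun_prop
      have h := this.tendsto 0
      simp only [zero_smul, add_zero] at h
      exact h.mono_left nhdsWithin_le_nhds
    refine mem_closure_of_tendsto hcont ?_
    filter_upwards [hcont.eventually (Metric.isOpen_ball.mem_nhds hw), self_mem_nhdsWithin]
      with t ht ht0
    rw [c.mem_iff_height_pos ht, c.height_add_smul, c.height_graphMap, zero_add]
    exact ht0
  · have := (c.mem_iff_height_pos hw).1 h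
    rw [c.height_graphMap] at this
    exact lt_irrefl _ this

theorem volume_eq (hd : 1 ≤ d) :
    (μHE[d - 1] : Measure (ℝ ∙ c.e)ᗮ) = volume := by
  have : Fact (Module.finrank ℝ (E d) = (d - 1) + 1) := ⟨by simp; omega⟩
  have hne : c.e ≠ 0 := fun h => by simpa [h] using c.norm_e
  rw [← InnerProductSpace.euclideanHausdorffMeasure_eq_volume,
    Submodule.finrank_orthogonal_span_singleton (n := d - 1) hne]

/-- In the chart the boundary is a (1+K)-Lipschitz image of the hyperplane, and such a map enlarges
(d-1)-dimensional Hausdorff measure by at most (1+K)^(d-1). This one-sided comparison replaces the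
area formula. -/
theorem lintegral_frontier_le (hd : 1 ≤ d) {S : Set (E d)}
    (hSf : S ⊆ frontier D.carrier ∩ Metric.ball x₀ c.r) (f : E d → ℝ≥0∞) (hf : Measurable f) :
    ∫⁻ x in S, f x ∂μHE[d - 1] ≤
      ((1 + c.K) ^ (d - 1) : NNReal) * ∫⁻ w : (ℝ ∙ c.e)ᗮ, f (c.graphMap w) := by
  have hmeas : Measurable c.graphMap := c.lipschitz_graphMap.continuous.measurable
  have hle : (μHE[d - 1] : Measure (E d)).restrict S ≤
      (((1 + c.K) ^ (d - 1) : NNReal) : ℝ≥0∞) •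
        ((volume : Measure (ℝ ∙ c.e)ᗮ).map c.graphMap) := by
    rw [Measure.le_iff]
    intro Z hZ
    rw [Measure.restrict_apply hZ, Measure.smul_apply, Measure.map_apply hmeas hZ, smul_eq_mul]
    have h1 : Z ∩ S ⊆ c.graphMap '' (c.graphMap ⁻¹' Z) := by
      rintro x ⟨hxZ, hxS⟩
      have hx := c.graphMap_proj (c.height_eq_zero (hSf hxS).2 (hSf hxS).1)
      exact ⟨c.proj x, by rwa [mem_preimage, hx], hx⟩
    refine (measure_mono h1).trans ?_
    rw [← c.volume_eq hd, Measure.euclideanHausdorffMeasure_def,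
      Measure.euclideanHausdorffMeasure_def, Measure.smul_apply, Measure.smul_apply,
      ENNReal.smul_def, ENNReal.smul_def, smul_eq_mul, smul_eq_mul, mul_left_comm]
    refine mul_le_mul_right ?_ _
    refine (c.lipschitz_graphMap.hausdorffMeasure_image_le (Nat.cast_nonneg _) _).trans ?_
    rw [ENNReal.rpow_natCast, ENNReal.coe_pow]
  calc ∫⁻ x in S, f x ∂μHE[d - 1]
      ≤ ∫⁻ x, f x ∂((((1 + c.K) ^ (d - 1) : NNReal) : ℝ≥0∞) •
        ((volume : Measure (ℝ ∙ c.e)ᗮ).map c.graphMap)) := lintegral_mono' hle le_rfl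
    _ = _ := by
        rw [lintegral_smul_measure, lintegral_map hf hmeas]
        rfl

/-- Integration over the collar `{p + t e : p ∈ ∂D, 0 < t ≤ h}`. -/
theorem exists_lintegral_collar_le (hd : 1 ≤ d) {h : ℝ} (hh : 2 * h ≤ c.r) :
    ∃ C : NNReal, ∀ g : E d → ℝ≥0∞, Measurable g →
      ∫⁻ p in frontier D.carrier ∩ Metric.ball x₀ h,
        (∫⁻ t in Ioc 0 h, g (p + t • c.e)) ∂μHE[d - 1] ≤ C * ∫⁻ x in D.carrier, g x := by
  obtain ⟨C, hC⟩ := exists_lintegral_orthogonal_lintegral_eq c.norm_e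
  have hSm : MeasurableSet (frontier D.carrier ∩ Metric.ball x₀ h) :=
    isClosed_frontier.measurableSet.inter Metric.isOpen_ball.measurableSet
  refine ⟨(1 + c.K) ^ (d - 1) * C, fun g hg => ?_⟩
  rcases le_or_gt h 0 with hh0 | hh0
  · simp [Ioc_eq_empty_of_le hh0]
  set G := D.carrier.indicator g with hG
  have hGm : Measurable G := hg.indicator D.isOpen.measurableSet
  have hGt : ∀ p, Measurable fun t : ℝ => G (p + t • c.e) := fun p =>
    hGm.comp (by fun_prop : Continuous fun t : ℝ => p + t • c.e).measurable
  have hV : Measurable fun p => ∫⁻ t : ℝ, G (p + t • c.e) :=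
    Measurable.lintegral_prod_right' (f := fun q : E d × ℝ => G (q.1 + q.2 • c.e))
      (hGm.comp (by fun_prop : Continuous fun q : E d × ℝ => q.1 + q.2 • c.e).measurable)
  calc ∫⁻ p in frontier D.carrier ∩ Metric.ball x₀ h,
        (∫⁻ t in Ioc 0 h, g (p + t • c.e)) ∂μHE[d - 1]
      ≤ ∫⁻ p in frontier D.carrier ∩ Metric.ball x₀ h,
        (∫⁻ t : ℝ, G (p + t • c.e)) ∂μHE[d - 1] := by
        refine setLIntegral_mono' hSm fun p hp => ?_
        refine le_trans ?_ (setLIntegral_le_lintegral (Ioc 0 h) _)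
        refine setLIntegral_mono' measurableSet_Ioc fun t ht => ?_
        have : p + t • c.e ∈ D.carrier :=
          c.add_smul_mem hp.2 (frontier_subset_closure hp.1) ht.1 (by linarith [ht.2])
        rw [hG, indicator_of_mem this]
    _ ≤ ((1 + c.K) ^ (d - 1) : NNReal) *
          ∫⁻ w : (ℝ ∙ c.e)ᗮ, ∫⁻ t : ℝ, G (c.graphMap w + t • c.e) :=
        c.lintegral_frontier_le hd
          (inter_subset_inter_right _ (Metric.ball_subset_ball (by linarith))) _ hV
    _ = ((1 + c.K) ^ (d - 1) : NNReal) * ∫⁻ w : (ℝ ∙ c.e)ᗮ, ∫⁻ t : ℝ, G (w + t • c.e) := by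
        -- For fixed w, translating t by γ(w) straightens the graph.
        congr 1
        refine lintegral_congr fun w => ?_
        rw [← lintegral_add_left_eq_self (μ := (volume : Measure ℝ))
          (fun t : ℝ => G (w + t • c.e)) (c.γ w)]
        simp only [graphMap, add_smul, add_assoc]
    _ = _ := by
        rw [hC G hGm, hG, lintegral_indicator D.isOpen.measurableSet, ENNReal.coe_mul, mul_assoc]

/-- |φ(p)|² ≤ 2|φ(p+te)|² + 2|φ(p)-φ(p+te)|², where the last square is at most h times the integral
of |∇φ|² along the segment. Integration over 0 < t ≤ h gives the claim. -/
theorem sq_le_collar {φ : E d → ℝ} (hφ : ContDiff ℝ 1 φ) {h : ℝ} (p : E d) :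
    ENNReal.ofReal h * ‖φ p‖ₑ ^ 2 ≤ 2 * (∫⁻ t in Ioc 0 h, ‖φ (p + t • c.e)‖ₑ ^ 2) +
      2 * ENNReal.ofReal h ^ 2 * ∫⁻ t in Ioc 0 h, ‖gradient φ (p + t • c.e)‖ₑ ^ 2 := by
  set A := ∫⁻ t in Ioc 0 h, ‖gradient φ (p + t • c.e)‖ₑ ^ 2
  have hm : Measurable fun t : ℝ => 2 * ‖φ (p + t • c.e)‖ₑ ^ 2 := by
    have := hφ.continuous
    exact ((ENNReal.continuous_pow 2).comp (Continuous.enorm (by fun_prop))).measurable.const_mul 2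
  calc ENNReal.ofReal h * ‖φ p‖ₑ ^ 2 = ∫⁻ _ in Ioc 0 h, ‖φ p‖ₑ ^ 2 := by
        rw [setLIntegral_const, Real.volume_Ioc, sub_zero, mul_comm]
    _ ≤ ∫⁻ t in Ioc 0 h, (2 * ‖φ (p + t • c.e)‖ₑ ^ 2 + 2 * (ENNReal.ofReal h * A)) := by
        refine setLIntegral_mono' measurableSet_Ioc fun t ht => ?_
        have h1 := enorm_add_sq_le (φ (p + t • c.e)) (φ p - φ (p + t • c.e))
        rw [add_sub_cancel, ← neg_sub (φ (p + t • c.e)) (φ p), enorm_neg] at h1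
        refine h1.trans ?_
        gcongr
        refine (enorm_sub_sq_le_lintegral_gradient hφ p c.e ht.1.le).trans ?_
        have he : ‖c.e‖ₑ = 1 := by rw [← ofReal_norm, c.norm_e, ENNReal.ofReal_one]
        rw [he, one_pow, one_mul]
        refine mul_le_mul' (ENNReal.ofReal_le_ofReal ht.2) ?_
        exact lintegral_mono_set (Ioc_subset_Ioc_right ht.2)
    _ = _ := by
        rw [lintegral_add_left hm, lintegral_const_mul' _ _ (by simp), setLIntegral_const,
          Real.volume_Ioc, sub_zero]
        ring

theorem exists_lintegral_trace_le (hd : 1 ≤ d) : ∃ C : NNReal, ∀ φ : E d → ℝ, ContDiff ℝ 1 φ →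
    ∫⁻ p in frontier D.carrier ∩ Metric.ball x₀ (c.r / 2), ‖φ p‖ₑ ^ 2 ∂μHE[d - 1] ≤
      C * ((∫⁻ x in D.carrier, ‖φ x‖ₑ ^ 2) + ∫⁻ x in D.carrier, ‖gradient φ x‖ₑ ^ 2) := by
  -- With this height, a boundary point within h of x₀ moved by at most h stays inside the chart.
  set h := c.r / 2 with hh
  have h0 : 0 < h := half_pos c.r_pos
  obtain ⟨C, hC⟩ := c.exists_lintegral_collar_le hd (h := h) (by rw [hh]; linarith)
  set C' : ℝ≥0∞ := (ENNReal.ofReal h)⁻¹ * (2 * C + 2 * ENNReal.ofReal h ^ 2 * C) with hC'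
  have hi : (ENNReal.ofReal h)⁻¹ ≠ ⊤ := ENNReal.inv_ne_top.2 (by simpa using h0)
  have hCt : C' ≠ ⊤ := by
    rw [hC']
    finiteness
  refine ⟨C'.toNNReal, fun φ hφ => ?_⟩
  rw [ENNReal.coe_toNNReal hCt]
  have hm1 : Measurable fun x => ‖φ x‖ₑ ^ 2 :=
    ((ENNReal.continuous_pow 2).comp hφ.continuous.enorm).measurable
  have hm2 : Measurable fun x => ‖gradient φ x‖ₑ ^ 2 :=
    ((ENNReal.continuous_pow 2).comp (continuous_gradient hφ).enorm).measurable
  have hV : ∀ g : E d → ℝ≥0∞, Measurable g →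
      Measurable fun p => ∫⁻ t in Ioc 0 h, g (p + t • c.e) := fun g hg =>
    Measurable.lintegral_prod_right' (f := fun q : E d × ℝ => g (q.1 + q.2 • c.e))
      (hg.comp (by fun_prop : Continuous fun q : E d × ℝ => q.1 + q.2 • c.e).measurable)
  set S := frontier D.carrier ∩ Metric.ball x₀ h
  calc ∫⁻ p in S, ‖φ p‖ₑ ^ 2 ∂μHE[d - 1]
      = (ENNReal.ofReal h)⁻¹ * ∫⁻ p in S, ENNReal.ofReal h * ‖φ p‖ₑ ^ 2 ∂μHE[d - 1] := by
        rw [lintegral_const_mul _ hm1, ← mul_assoc,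
          ENNReal.inv_mul_cancel (by simpa using h0) ENNReal.ofReal_ne_top, one_mul]
    _ ≤ (ENNReal.ofReal h)⁻¹ * ∫⁻ p in S, (2 * (∫⁻ t in Ioc 0 h, ‖φ (p + t • c.e)‖ₑ ^ 2) +
          2 * ENNReal.ofReal h ^ 2 *
            ∫⁻ t in Ioc 0 h, ‖gradient φ (p + t • c.e)‖ₑ ^ 2) ∂μHE[d - 1] := by
        refine mul_le_mul_right (lintegral_mono fun p => ?_) _
        exact c.sq_le_collar hφ p
    _ ≤ (ENNReal.ofReal h)⁻¹ * (2 * (C * ∫⁻ x in D.carrier, ‖φ x‖ₑ ^ 2) +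
          2 * ENNReal.ofReal h ^ 2 * (C * ∫⁻ x in D.carrier, ‖gradient φ x‖ₑ ^ 2)) := by
        rw [lintegral_add_left ((hV _ hm1).const_mul 2), lintegral_const_mul _ (hV _ hm1),
          lintegral_const_mul _ (hV _ hm2)]
        gcongr
        · exact hC _ hm1
        · exact hC _ hm2
    _ ≤ C' * ((∫⁻ x in D.carrier, ‖φ x‖ₑ ^ 2) + ∫⁻ x in D.carrier, ‖gradient φ x‖ₑ ^ 2) := by
        rw [hC', mul_assoc (ENNReal.ofReal h)⁻¹]
        refine mul_le_mul_right ?_ _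
        calc _ = 2 * C * (∫⁻ x in D.carrier, ‖φ x‖ₑ ^ 2) + 2 * ENNReal.ofReal h ^ 2 * C *
              ∫⁻ x in D.carrier, ‖gradient φ x‖ₑ ^ 2 := by ring
          _ ≤ _ := by
            rw [add_mul]
            gcongr
            · exact le_self_add
            · exact le_add_self

/-- The orthogonal projection is a contraction, so it cannot increase Hausdorff measure. The image
of the boundary piece contains a neighbourhood of the projected x₀ in the hyperplane, which has
positive Lebesgue measure. -/
theorem surface_inter_pos (c : GraphChart D x₀) (hd : 1 ≤ d) (hx₀ : x₀ ∈ frontier D.carrier) {O : Set (E d)}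
    (hO : O ∈ 𝓝 x₀) : 0 < μHE[d - 1] (O ∩ frontier D.carrier) := by
  have h0 : c.graphMap (c.proj x₀) = x₀ :=
    c.graphMap_proj (c.height_eq_zero (Metric.mem_ball_self c.r_pos) hx₀)
  set Z := c.graphMap ⁻¹' (O ∩ Metric.ball x₀ c.r) with hZ
  have hZn : Z ∈ 𝓝 (c.proj x₀) := by
    refine c.lipschitz_graphMap.continuous.continuousAt.preimage_mem_nhds ?_
    rw [h0]
    exact inter_mem hO (Metric.ball_mem_nhds x₀ c.r_pos)
  have hpos : 0 < (volume : Measure (ℝ ∙ c.e)ᗮ) Z := Measure.measure_pos_of_mem_nhds _ hZn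
  refine hpos.trans_le ?_
  have hsub : Z ⊆ c.proj '' (O ∩ frontier D.carrier) := fun w hw =>
    ⟨c.graphMap w, ⟨hw.1, c.graphMap_mem_frontier hw.2⟩, c.proj_graphMap w⟩
  have hlip : LipschitzWith 1 c.proj := by
    refine LipschitzWith.of_dist_le_mul fun x y => ?_
    rw [dist_eq_norm, dist_eq_norm, ← map_sub, NNReal.coe_one, one_mul]
    exact Submodule.norm_orthogonalProjectionOnto_apply_le _ _
  refine (measure_mono hsub).trans ?_
  rw [← c.volume_eq hd, Measure.euclideanHausdorffMeasure_def,
    Measure.euclideanHausdorffMeasure_def, Measure.smul_apply, Measure.smul_apply,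
    ENNReal.smul_def, ENNReal.smul_def, smul_eq_mul, smul_eq_mul]
  refine mul_le_mul_right ?_ _
  refine (hlip.hausdorffMeasure_image_le (Nat.cast_nonneg _) _).trans ?_
  simp

end GraphChart

/-- The trace inequality on a bounded Lipschitz domain, for smooth functions. -/
theorem exists_lintegral_surface_sq_le (hd : 1 ≤ d) (D : LipschitzDomain d) :
    ∃ C : NNReal, ∀ φ : E d → ℝ, ContDiff ℝ 1 φ →
      ∫⁻ x, ‖φ x‖ₑ ^ 2 ∂(surface D) ≤
        C * ((∫⁻ x in D.carrier, ‖φ x‖ₑ ^ 2) + ∫⁻ x in D.carrier, ‖gradient φ x‖ₑ ^ 2) := by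
  set P : Set (E d) → Prop := fun S => ∃ C : NNReal, ∀ φ : E d → ℝ, ContDiff ℝ 1 φ →
    ∫⁻ x in frontier D.carrier ∩ S, ‖φ x‖ₑ ^ 2 ∂μHE[d - 1] ≤
        C * ((∫⁻ x in D.carrier, ‖φ x‖ₑ ^ 2) + ∫⁻ x in D.carrier, ‖gradient φ x‖ₑ ^ 2) with hP
  have hcompact : IsCompact (frontier D.carrier) :=
    D.isBounded.isCompact_closure.of_isClosed_subset isClosed_frontier frontier_subset_closure
  have h : P (frontier D.carrier) := by
    refine hcompact.induction_on ⟨0, fun φ _ => by simp⟩ ?_ ?_ ?_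
    · exact fun s t hst ⟨C, hC⟩ => ⟨C, fun φ hφ =>
        (lintegral_mono_set (inter_subset_inter_right _ hst)).trans (hC φ hφ)⟩
    · exact fun s t ⟨C, hC⟩ ⟨C', hC'⟩ => ⟨C + C', fun φ hφ => by
        rw [inter_union_distrib_left, ENNReal.coe_add, add_mul]
        exact (lintegral_union_le _ _ _).trans (add_le_add (hC φ hφ) (hC' φ hφ))⟩
    · intro x hx
      obtain ⟨c⟩ := D.exists_graphChart hx
      exact ⟨_, mem_nhdsWithin_of_mem_nhds (Metric.ball_mem_nhds x (half_pos c.r_pos)),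
        c.exists_lintegral_trace_le hd⟩
  simpa [hP] using h

/-- The trace inequality for φ = 1 on the bounded set D. -/
theorem surface_univ_lt_top (hd : 1 ≤ d) (D : LipschitzDomain d) : surface D univ < ⊤ := by
  obtain ⟨C, hC⟩ := exists_lintegral_surface_sq_le hd D
  have h := hC (fun _ => 1) contDiff_const
  have hg : ∀ x : E d, gradient (fun _ : E d => (1 : ℝ)) x = 0 := fun x => gradient_const x 1
  simp only [hg, enorm_one, one_pow, lintegral_one, enorm_zero, ne_eq, OfNat.ofNat_ne_zero,
    not_false_eq_true, zero_pow, lintegral_zero, add_zero] at h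
  refine h.trans_lt (ENNReal.mul_lt_top ENNReal.coe_lt_top (measure_lt_top _ _))

theorem surface_electrode_pos {M : ℕ} (hd : 1 ≤ d) {D : LipschitzDomain d} (El : Electrodes D M)
    (k : Fin M) : 0 < surface D (El.set k) := by
  obtain ⟨O, hO, hset⟩ := El.isRelOpen k
  obtain ⟨x₀, hx₀⟩ := (El.isConnected k).nonempty
  rw [hset] at hx₀ ⊢
  obtain ⟨c⟩ := D.exists_graphChart hx₀.2
  rw [Measure.restrict_apply' isClosed_frontier.measurableSet, inter_assoc, inter_self]
  exact c.surface_inter_pos hd hx₀.2 (hO.mem_nhds hx₀.1)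

end Trace

/-! ## Mollification in `L²` -/

section Mollification

theorem sq_eLpNorm_two {α F : Type*} [MeasurableSpace α] {μ : Measure α} [NormedAddCommGroup F]
    (f : α → F) : eLpNorm f 2 μ ^ 2 = ∫⁻ x, ‖f x‖ₑ ^ 2 ∂μ := by
  have := eLpNorm_nnreal_pow_eq_lintegral (μ := μ) (f := f) (p := 2) two_ne_zero
  simpa using this

variable {d : ℕ} {F : Type*} [NormedAddCommGroup F]

/-- Continuity of translations in L², at the zero translation. -/
theorem exists_forall_lintegral_translation_sub_sq_le {w : E d → F} (hw : MemLp w 2 volume)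
    {η : ℝ≥0∞} (hη : η ≠ 0) :
    ∃ ε > 0, ∀ z ∈ Metric.closedBall (0 : E d) ε, ∫⁻ x, ‖w (x - z) - w x‖ₑ ^ 2 ≤ η := by
  set W : Lp F 2 (volume : Measure (E d)) := hw.toLp w with hW
  have : Fact ((2 : ℝ≥0∞) ≠ ⊤) := ⟨by simp⟩
  have hcont : Continuous fun z : E d => DomAddAct.mk (-z) +ᵥ W :=
    (DomAddAct.continuous_mk.comp continuous_neg).vadd continuous_const
  have h0 : DomAddAct.mk (-(0 : E d)) +ᵥ W = W := by
    rw [neg_zero, DomAddAct.mk_zero, zero_vadd]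
  have hev : ∀ᶠ z : E d in 𝓝 0, edist (DomAddAct.mk (-z) +ᵥ W) W ^ 2 < η := by
    have h1 : Tendsto (fun z : E d => edist (DomAddAct.mk (-z) +ᵥ W) W ^ 2) (𝓝 0) (𝓝 0) := by
      have h2 : Continuous fun z : E d => edist (DomAddAct.mk (-z) +ᵥ W) W ^ 2 :=
        (ENNReal.continuous_pow 2).comp (hcont.edist continuous_const)
      have h3 := h2.tendsto 0
      rwa [h0, edist_self, zero_pow two_ne_zero] at h3
    exact h1.eventually_lt_const (pos_iff_ne_zero.2 hη)
  obtain ⟨ε, hε, h⟩ := Metric.nhds_basis_closedBall.mem_iff.1 hev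
  refine ⟨ε, hε, fun z hz => ?_⟩
  have h1 : edist (DomAddAct.mk (-z) +ᵥ W) W ^ 2 ≤ η := le_of_lt (h hz)
  rw [hW, DomAddAct.mk_vadd_toLp, Lp.edist_toLp_toLp, sq_eLpNorm_two] at h1
  refine le_of_eq_of_le (lintegral_congr fun x => ?_) h1
  rw [Pi.sub_apply, vadd_eq_add, neg_add_eq_sub]

/-- The kernel is a probability density, so the error is an average of w(x-z) - w(x) over z.
Cauchy–Schwarz moves the square inside and Tonelli exchanges the integrals. The kernel need not be
centred at 0; only the translations in its support matter. -/
theorem lintegral_mollify_sub_sq_le [NormedSpace ℝ F] [CompleteSpace F] {w : E d → F}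
    (hwm : StronglyMeasurable w) (hw : LocallyIntegrable w volume) {k : E d → ℝ}
    (hk : Continuous k) (hkc : HasCompactSupport k) (hk0 : ∀ x, 0 ≤ k x) (hk1 : ∫ x, k x = 1)
    {η : ℝ≥0∞} (hη : ∀ z ∈ tsupport k, ∫⁻ x, ‖w (x - z) - w x‖ₑ ^ 2 ≤ η) :
    ∫⁻ x, ‖(∫ y, k (x - y) • w y) - w x‖ₑ ^ 2 ≤ η := by
  have hki : Integrable k := hk.integrable_of_hasCompactSupport hkc
  have hkl : ∫⁻ z, ENNReal.ofReal (k z) = 1 := by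
    rw [← ofReal_integral_eq_lintegral_ofReal hki (Eventually.of_forall hk0), hk1,
      ENNReal.ofReal_one]
  have hkm : Measurable fun z => ENNReal.ofReal (k z) := hk.measurable.ennreal_ofReal
  set ν : Measure (E d) := volume.withDensity fun z => ENNReal.ofReal (k z) with hν
  have hνu : ν univ = 1 := by
    rw [hν, withDensity_apply _ MeasurableSet.univ, Measure.restrict_univ, hkl]
  have hjoint : Measurable fun p : E d × E d => ‖w (p.1 - p.2) - w p.1‖ₑ ^ 2 := by
    have h1 : StronglyMeasurable fun p : E d × E d => w (p.1 - p.2) - w p.1 :=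
      (hwm.comp_measurable (measurable_fst.sub measurable_snd)).sub
        (hwm.comp_measurable measurable_fst)
    exact h1.enorm.pow_const 2
  have hdiff : ∀ x, ‖(∫ y, k (x - y) • w y) - w x‖ₑ ^ 2 ≤
      ∫⁻ z, ‖w (x - z) - w x‖ₑ ^ 2 ∂ν := by
    intro x
    have hmx : Measurable fun z => ‖w (x - z) - w x‖ₑ :=
      ((hwm.comp_measurable (measurable_const.sub measurable_id)).sub
        stronglyMeasurable_const).enorm
    have hint0 : Integrable fun y => k (x - y) • w y := by
      refine hw.integrable_smul_left_of_hasCompactSupport (by fun_prop) ?_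
      exact hkc.comp_homeomorph (Homeomorph.subLeft x)
    have hint : Integrable fun z => k z • w (x - z) := by
      have := hint0.comp_sub_left x
      simpa using this
    have e1 : ∫ y, k (x - y) • w y = ∫ z, k z • w (x - z) := by
      rw [← integral_sub_left_eq_self _ volume x]
      simp
    have e2 : w x = ∫ z, k z • w x := by
      rw [integral_smul_const, hk1, one_smul]
    have e3 : (∫ y, k (x - y) • w y) - w x = ∫ z, k z • (w (x - z) - w x) := by
      rw [e1]
      conv_lhs => rw [e2]
      rw [← integral_sub hint (hki.smul_const _)]
      simp only [smul_sub]
    rw [e3]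
    calc ‖∫ z, k z • (w (x - z) - w x)‖ₑ ^ 2
        ≤ (∫⁻ z, ‖k z • (w (x - z) - w x)‖ₑ) ^ 2 := by
          gcongr
          exact enorm_integral_le_lintegral_enorm _
      _ = (∫⁻ z, ‖w (x - z) - w x‖ₑ ∂ν) ^ 2 := by
          rw [hν, lintegral_withDensity_eq_lintegral_mul _ hkm hmx]
          congr 1
          refine lintegral_congr fun z => ?_
          rw [enorm_smul, Real.enorm_of_nonneg (hk0 z)]
          rfl
      _ ≤ ν univ * ∫⁻ z, ‖w (x - z) - w x‖ₑ ^ 2 ∂ν := sq_lintegral_le hmx.aemeasurable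
      _ = _ := by rw [hνu, one_mul]
  calc ∫⁻ x, ‖(∫ y, k (x - y) • w y) - w x‖ₑ ^ 2
      ≤ ∫⁻ x, ∫⁻ z, ‖w (x - z) - w x‖ₑ ^ 2 ∂ν := lintegral_mono hdiff
    _ = ∫⁻ z, (∫⁻ x, ‖w (x - z) - w x‖ₑ ^ 2) ∂ν := by
        have : IsFiniteMeasure ν := ⟨by rw [hνu]; exact ENNReal.one_lt_top⟩
        exact lintegral_lintegral_swap (μ := volume) (ν := ν)
          (f := fun x z => ‖w (x - z) - w x‖ₑ ^ 2) hjoint.aemeasurable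
    _ = ∫⁻ z, ENNReal.ofReal (k z) * ∫⁻ x, ‖w (x - z) - w x‖ₑ ^ 2 := by
        have hm : Measurable fun z => ∫⁻ x, ‖w (x - z) - w x‖ₑ ^ 2 := hjoint.lintegral_prod_left'
        exact lintegral_withDensity_eq_lintegral_mul volume hkm hm
    _ ≤ ∫⁻ z, ENNReal.ofReal (k z) * η := by
        refine lintegral_mono fun z => ?_
        by_cases hz : z ∈ tsupport k
        · exact mul_le_mul_right (hη z hz) _
        · rw [image_eq_zero_of_notMem_tsupport hz]
          simp
    _ = η := by rw [lintegral_mul_const _ hkm, hkl, one_mul]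

theorem hasFDerivAt_mollify {w : E d → ℝ} (hw : LocallyIntegrable w volume) {k : E d → ℝ}
    (hk : ContDiff ℝ ∞ k) (hkc : HasCompactSupport k) :
    ContDiff ℝ ∞ (fun x => ∫ y, k (x - y) • w y) ∧
      ∀ x, gradient (fun x => ∫ y, k (x - y) • w y) x = ∫ y, w y • gradient k (x - y) := by
  have hconv : (fun x => ∫ y, k (x - y) • w y) =
      convolution w k (ContinuousLinearMap.mul ℝ ℝ) volume := by
    ext x
    rw [convolution_def]
    refine integral_congr_ae (Eventually.of_forall fun y => ?_)
    exact mul_comm _ _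
  rw [hconv]
  refine ⟨hkc.contDiff_convolution_right _ hw hk, fun x => ?_⟩
  have hk1 : ContDiff ℝ 1 k := hk.of_le (by simp)
  have hgc : Continuous (gradient k) := continuous_gradient hk1
  have hgs : HasCompactSupport (gradient k) :=
    (hkc.fderiv ℝ).comp_left (g := (InnerProductSpace.toDual ℝ (E d)).symm) (map_zero _)
  have hint : Integrable fun y => w y • gradient k (x - y) :=
    hw.integrable_smul_right_of_hasCompactSupport (by fun_prop)
      (hgs.comp_homeomorph (Homeomorph.subLeft x))
  refine ext_inner_right ℝ fun u => ?_
  rw [gradient, InnerProductSpace.toDual_symm_apply,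
    (hkc.hasFDerivAt_convolution_right _ hw hk1 x).fderiv,
    convolution_precompR_apply _ hw (hkc.fderiv ℝ) (hk1.continuous_fderiv (by simp)),
    real_inner_comm, ← integral_inner hint, convolution_def]
  refine integral_congr_ae (Eventually.of_forall fun y => ?_)
  simp only [ContinuousLinearMap.mul_apply']
  rw [inner_smul_right, real_inner_comm, gradient, InnerProductSpace.toDual_symm_apply]

end Mollification

/-! ### One-sided mollifiers near the boundary -/

section Kernels

variable {d : ℕ}

/-- Near every point of the closure of `D` there are mollifiers that only evaluate functions at
points of `D`. -/
theorem exists_mollifier (D : LipschitzDomain d) {x₀ : E d} (hx₀ : x₀ ∈ closure D.carrier) :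
    ∃ ρ > 0, ∀ ε > 0, ∃ k : E d → ℝ, ContDiff ℝ ∞ k ∧ HasCompactSupport k ∧ (∀ x, 0 ≤ k x) ∧
      ∫ x, k x = 1 ∧ tsupport k ⊆ Metric.closedBall 0 ε ∧
      ∀ x ∈ D.carrier, ∀ y ∈ Metric.ball x₀ ρ, x - y ∈ tsupport k → y ∈ D.carrier := by
  have hbump : ∀ (a : E d) (δ : ℝ), 0 < δ → ∃ k : E d → ℝ, ContDiff ℝ ∞ k ∧
      HasCompactSupport k ∧ (∀ x, 0 ≤ k x) ∧ ∫ x, k x = 1 ∧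
      tsupport k = Metric.closedBall a δ := by
    intro a δ hδ
    let f : ContDiffBump a := ⟨δ / 2, δ, half_pos hδ, half_lt_self hδ⟩
    exact ⟨f.normed volume, f.contDiff_normed, f.hasCompactSupport_normed, f.nonneg_normed,
      f.integral_normed, f.tsupport_normed_eq⟩
  rw [closure_eq_self_union_frontier] at hx₀
  rcases hx₀ with hx₀ | hx₀
  · obtain ⟨ρ, hρ, hb⟩ := Metric.isOpen_iff.1 D.isOpen x₀ hx₀
    refine ⟨ρ, hρ, fun ε hε => ?_⟩
    obtain ⟨k, h1, h2, h3, h4, h5⟩ := hbump 0 ε hε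
    exact ⟨k, h1, h2, h3, h4, h5.le, fun x _ y hy _ => hb hy⟩
  · obtain ⟨c⟩ := D.exists_graphChart hx₀
    have hr := c.r_pos
    refine ⟨c.r / 2, half_pos hr, fun ε hε => ?_⟩
    set s := min ε (c.r / 2) / 2 with hs
    have hs0 : 0 < s := by positivity
    have hsε : 2 * s ≤ ε := by rw [hs]; linarith [min_le_left ε (c.r / 2)]
    have hsr : 2 * s ≤ c.r / 2 := by rw [hs]; linarith [min_le_right ε (c.r / 2)]
    have hK : (0 : ℝ) ≤ c.K := c.K.2
    -- The height is (1+K)-Lipschitz, so a displacement by δ changes it by at most s/2, half of what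
    -- the shift by s gains.
    set δ := s / (2 * (1 + c.K)) with hδ
    have hδ0 : 0 < δ := by positivity
    have hδs : (1 + c.K) * δ = s / 2 := by
      rw [hδ]
      field_simp
    have hδs' : δ ≤ s / 2 := by nlinarith
    -- With the bump centred at -s e, the mollification at x evaluates at points y within δ of x + s
    -- e; their height exceeds that of x by at least s/2.
    obtain ⟨k, h1, h2, h3, h4, h5⟩ := hbump (-(s • c.e)) δ hδ0
    have hse : ‖s • c.e‖ = s := c.norm_smul_e hs0.le
    have hsub : tsupport k ⊆ Metric.closedBall 0 (3 / 2 * s) := by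
      rw [h5]
      refine Metric.closedBall_subset_closedBall' ?_
      rw [dist_zero_right, norm_neg, hse]
      linarith
    refine ⟨k, h1, h2, h3, h4, hsub.trans (Metric.closedBall_subset_closedBall (by linarith)),
      fun x hx y hy hxy => ?_⟩
    have hxb : x ∈ Metric.ball x₀ c.r := by
      have := hsub hxy
      rw [mem_closedBall_zero_iff] at this
      rw [mem_ball_iff_norm] at hy ⊢
      calc ‖x - x₀‖ = ‖(x - y) + (y - x₀)‖ := by congr 1; abel
        _ ≤ ‖x - y‖ + ‖y - x₀‖ := norm_add_le _ _
        _ < c.r := by linarith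
    have hpos := (c.mem_iff_height_pos hxb).1 hx
    rw [h5, mem_closedBall_iff_norm] at hxy
    have h6 := c.abs_height_sub_le (x + s • c.e) y
    have e : x + s • c.e - y = x - y - -(s • c.e) := by abel
    rw [e, c.height_add_smul] at h6
    have h7 : (1 + (c.K : ℝ)) * ‖x - y - -(s • c.e)‖ ≤ s / 2 := by
      rw [← hδs]
      gcongr
    rw [c.mem_iff_height_pos (Metric.ball_subset_ball (by linarith) hy)]
    linarith [(abs_le.1 (h6.trans h7)).2]

end Kernels

/-! ## Density of smooth functions in `H¹(D)` -/

section Density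

variable {d : ℕ} {D : LipschitzDomain d}

theorem gradient_apply_eq {φ : E d → ℝ} (x u : E d) :
    inner ℝ (gradient φ x) u = fderiv ℝ φ x u := by
  rw [gradient, InnerProductSpace.toDual_symm_apply]

theorem hasCompactSupport_gradient {φ : E d → ℝ} (h : HasCompactSupport φ) :
    HasCompactSupport (gradient φ) :=
  (h.fderiv ℝ).comp_left (g := (InnerProductSpace.toDual ℝ (E d)).symm) (map_zero _)

theorem memLp_cutoff {F : Type*} [NormedAddCommGroup F] [NormedSpace ℝ F] {χ : E d → ℝ}
    (hχ : Continuous χ) (hc : HasCompactSupport χ) (v : Lp F 2 (volD D)) :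
    MemLp (fun x => χ x • v x) 2 (volD D) :=
  (Lp.memLp v).smul (p := ∞) (hχ.memLp_top_of_hasCompactSupport hc _)

theorem memLp_smul_cutoff {F : Type*} [NormedAddCommGroup F] [NormedSpace ℝ F] {g : E d → F}
    (hg : Continuous g) (hc : HasCompactSupport g) (v : L2 D) :
    MemLp (fun x => v x • g x) 2 (volD D) :=
  (hg.memLp_top_of_hasCompactSupport hc _).smul (p := 2) (q := ∞) (Lp.memLp v)

theorem memLp_cutoff_gradient {χ : E d → ℝ} (hχ : ContDiff ℝ ∞ χ) (hc : HasCompactSupport χ)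
    (p : L2 D × L2vec D) :
    MemLp (fun x => χ x • p.2 x + p.1 x • gradient χ x) 2 (volD D) :=
  (memLp_cutoff hχ.continuous hc p.2).add (memLp_smul_cutoff
    (continuous_gradient (hχ.of_le (by simp))) (hasCompactSupport_gradient hc) p.1)

/-- The product of a cut-off function with an element of `H¹(D)`, with its weak gradient. -/
def cutoff (D : LipschitzDomain d) {χ : E d → ℝ} (hχ : ContDiff ℝ ∞ χ) (hc : HasCompactSupport χ)
    (p : L2 D × L2vec D) : L2 D × L2vec D :=
  ((memLp_cutoff hχ.continuous hc p.1).toLp _,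
    (memLp_cutoff_gradient hχ hc p).toLp _)

/-- The mollification estimate uses Tonelli for w(x-z) - w(x), which is why a strongly measurable
representative of the extension by zero is fixed. -/
theorem stronglyMeasurable_indicator_of_memLp {F : Type*} [NormedAddCommGroup F] {f : E d → F}
    (hf : MemLp f 2 (volD D)) : ∃ g : E d → F, StronglyMeasurable g ∧ MemLp g 2 volume ∧
      g =ᵐ[volume] D.carrier.indicator f := by
  have h : MemLp (D.carrier.indicator f) 2 volume :=
    (memLp_indicator_iff_restrict D.isOpen.measurableSet).2 hf
  exact ⟨h.1.mk _, h.1.stronglyMeasurable_mk, (memLp_congr_ae h.1.ae_eq_mk).1 h,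
    h.1.ae_eq_mk.symm⟩

theorem integral_eq_of_ae_eq_indicator {F G : Type*} [NormedAddCommGroup F] [NormedSpace ℝ F]
    [NormedAddCommGroup G] [NormedSpace ℝ G] {g f : E d → F}
    (hg : g =ᵐ[volume] D.carrier.indicator f) (Φ : E d → F → G) (h0 : ∀ y, Φ y 0 = 0) :
    ∫ y, Φ y (g y) = ∫ y in D.carrier, Φ y (f y) := by
  rw [← integral_indicator D.isOpen.measurableSet]
  refine integral_congr_ae ?_
  filter_upwards [hg] with y hy
  rw [hy]
  by_cases h : y ∈ D.carrier <;> simp [h, h0]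

theorem gradient_mul_comp_sub {χ k : E d → ℝ} (hχ : ContDiff ℝ ∞ χ) (hk : ContDiff ℝ ∞ k)
    (x y : E d) : gradient (fun y => χ y * k (x - y)) y =
      k (x - y) • gradient χ y - χ y • gradient k (x - y) := by
  refine ext_inner_right ℝ fun u => ?_
  have h1 : HasFDerivAt χ (fderiv ℝ χ y) y := (hχ.differentiable (by simp) y).hasFDerivAt
  have h2 : HasFDerivAt (fun y => k (x - y)) (-fderiv ℝ k (x - y)) y := by
    have h3 : HasFDerivAt k (fderiv ℝ k (x - y)) (x - y) :=
      (hk.differentiable (by simp) _).hasFDerivAt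
    have h4 : HasFDerivAt (fun y => x - y) (-ContinuousLinearMap.id ℝ (E d)) y :=
      (hasFDerivAt_id y).const_sub x
    have h5 := h3.comp y h4
    rwa [ContinuousLinearMap.comp_neg, ContinuousLinearMap.comp_id] at h5
  rw [gradient_apply_eq, (h1.fun_mul h2).fderiv, inner_sub_left, inner_smul_left, inner_smul_left,
    gradient_apply_eq, gradient_apply_eq]
  simp only [add_apply, smul_apply,
    neg_apply, smul_eq_mul, conj_trivial]
  ring

/-- The gradient of the mollification of `χ v` is the mollification of its weak gradient. -/
theorem integral_cutoff_gradient_eq {p : L2 D × L2vec D} (hp : p ∈ H1 D) {χ k : E d → ℝ}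
    (hχ : ContDiff ℝ ∞ χ) (hχc : HasCompactSupport χ) (hk : ContDiff ℝ ∞ k) (x : E d)
    (hx : ∀ y ∈ tsupport χ, x - y ∈ tsupport k → y ∈ D.carrier) :
    ∫ y in D.carrier, (χ y • p.1 y) • gradient k (x - y) =
      ∫ y in D.carrier, k (x - y) • (χ y • p.2 y + p.1 y • gradient χ y) := by
  -- The product is an admissible test function: `hx` keeps its support inside D, although neither
  -- factor alone need be supported there.
  set ψ : E d → ℝ := fun y => χ y * k (x - y) with hψ
  have hkx : ContDiff ℝ ∞ fun y => k (x - y) := hk.comp (contDiff_const.sub contDiff_id)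
  have hψs : ContDiff ℝ ∞ ψ := hχ.mul hkx
  have hψc : HasCompactSupport ψ := hχc.mul_right
  have hsupp : tsupport ψ ⊆ D.carrier := by
    intro y hy
    refine hx y (tsupport_mul_subset_left hy) ?_
    have h1 : y ∈ tsupport fun y => k (x - y) := tsupport_mul_subset_right hy
    have h2 := tsupport_comp_subset_preimage k (f := fun y => x - y) (by fun_prop)
    exact h2 h1
  have hp' : IsWeakGradient D p.1 p.2 := hp
  have hweak := hp' ψ hψs hψc hsupp
  have hvl : LocallyIntegrable p.1 (volD D) :=
    ((Lp.memLp p.1).integrable (by norm_num)).locallyIntegrable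
  have hχg : Continuous (gradient χ) := continuous_gradient (hχ.of_le (by simp))
  have hXc : HasCompactSupport fun y => k (x - y) • gradient χ y :=
    HasCompactSupport.smul_left (f := fun y => k (x - y)) (hasCompactSupport_gradient hχc)
  have hi1 : Integrable (fun y => p.1 y • (k (x - y) • gradient χ y)) (volD D) :=
    hvl.integrable_smul_right_of_hasCompactSupport (hkx.continuous.smul hχg) hXc
  have alg1 : ∀ (a b c : ℝ) (X Y Z : E d), Z = b • X - a • Y →
      c • (b • X) - c • Z = (a • c) • Y := by
    rintro a b c X Y Z rfl
    rw [smul_eq_mul]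
    module
  have alg2 : ∀ (a b c : ℝ) (X Y : E d), c • (b • X) + (a * b) • Y = b • (a • Y + c • X) := by
    intros
    module
  have hi2 := integrable_smul_gradient p.1 hψs hψc
  have hi3 := integrable_smul_vec p.2 hψs hψc
  calc ∫ y in D.carrier, (χ y • p.1 y) • gradient k (x - y)
      = ∫ y in D.carrier, (p.1 y • (k (x - y) • gradient χ y) - p.1 y • gradient ψ y) := by
        refine integral_congr_ae (Eventually.of_forall fun y => ?_)
        exact (alg1 _ _ _ _ _ _ (gradient_mul_comp_sub hχ hk x y)).symm
    _ = ∫ y in D.carrier, (p.1 y • (k (x - y) • gradient χ y) + ψ y • p.2 y) := by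
        rw [integral_sub hi1 hi2, integral_add hi1 hi3, hweak, sub_neg_eq_add]
    _ = _ := by
        refine integral_congr_ae (Eventually.of_forall fun y => ?_)
        exact alg2 _ _ _ _ _

/-- The extension of χv by zero may jump across ∂D, so its weak gradient on ℝ^d is not the extended
one. For x in D, however, the one-sided kernel sees only points of D, and there mollification
commutes with the weak gradient. -/
theorem exists_smooth_near_cutoff {p : L2 D × L2vec D} (hp : p ∈ H1 D) {χ : E d → ℝ}
    (hχ : ContDiff ℝ ∞ χ) (hχc : HasCompactSupport χ)
    (hmol : ∀ ε > 0, ∃ k : E d → ℝ, ContDiff ℝ ∞ k ∧ HasCompactSupport k ∧ (∀ x, 0 ≤ k x) ∧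
      ∫ x, k x = 1 ∧ tsupport k ⊆ Metric.closedBall 0 ε ∧
      ∀ x ∈ D.carrier, ∀ y ∈ tsupport χ, x - y ∈ tsupport k → y ∈ D.carrier)
    {η : ℝ≥0∞} (hη : η ≠ 0) :
    ∃ φ : E d → ℝ, ContDiff ℝ ∞ φ ∧
      ∫⁻ x in D.carrier, ‖φ x - (cutoff D hχ hχc p).1 x‖ₑ ^ 2 ≤ η ∧
      ∫⁻ x in D.carrier, ‖gradient φ x - (cutoff D hχ hχc p).2 x‖ₑ ^ 2 ≤ η := by
  set f : E d → ℝ := fun x => χ x • p.1 x with hf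
  set g : E d → E d := fun x => χ x • p.2 x + p.1 x • gradient χ x with hg
  have hfm : MemLp f 2 (volD D) := memLp_cutoff hχ.continuous hχc p.1
  have hgm : MemLp g 2 (volD D) := memLp_cutoff_gradient hχ hχc p
  obtain ⟨w, hw1, hw2, hw3⟩ := stronglyMeasurable_indicator_of_memLp hfm
  obtain ⟨W, hW1, hW2, hW3⟩ := stronglyMeasurable_indicator_of_memLp hgm
  obtain ⟨ε₁, hε₁, h1⟩ := exists_forall_lintegral_translation_sub_sq_le hw2 hη
  obtain ⟨ε₂, hε₂, h2⟩ := exists_forall_lintegral_translation_sub_sq_le hW2 hη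
  obtain ⟨k, hk, hkc, hk0, hk1, hks, hkD⟩ := hmol (min ε₁ ε₂) (lt_min hε₁ hε₂)
  have hwl : LocallyIntegrable w volume := hw2.locallyIntegrable (by norm_num)
  have hWl : LocallyIntegrable W volume := hW2.locallyIntegrable (by norm_num)
  obtain ⟨hφs, hφg⟩ := hasFDerivAt_mollify hwl hk hkc
  refine ⟨_, hφs, ?_, ?_⟩
  · refine le_trans (le_of_eq_of_le ?_ (setLIntegral_le_lintegral D.carrier _))
      (lintegral_mollify_sub_sq_le hw1 hwl hk.continuous hkc hk0 hk1
      fun z hz => h1 z (Metric.closedBall_subset_closedBall (min_le_left _ _) (hks hz)))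
    refine lintegral_congr_ae ?_
    filter_upwards [hfm.coeFn_toLp, ae_restrict_of_ae hw3,
      ae_restrict_mem D.isOpen.measurableSet] with x hx hx' hxD
    rw [indicator_of_mem hxD] at hx'
    have : (cutoff D hχ hχc p).1 x = f x := hx
    rw [this, hx']
  · refine le_trans (le_of_eq_of_le ?_ (setLIntegral_le_lintegral D.carrier _))
      (lintegral_mollify_sub_sq_le hW1 hWl hk.continuous hkc hk0 hk1
      fun z hz => h2 z (Metric.closedBall_subset_closedBall (min_le_right _ _) (hks hz)))
    refine lintegral_congr_ae ?_
    filter_upwards [hgm.coeFn_toLp, ae_restrict_of_ae hW3,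
      ae_restrict_mem D.isOpen.measurableSet] with x hx hx' hxD
    rw [indicator_of_mem hxD] at hx'
    have h3 : (cutoff D hχ hχc p).2 x = g x := hx
    rw [h3, hx', hφg, integral_eq_of_ae_eq_indicator hw3 (fun y r => r • gradient k (x - y))
      (fun y => zero_smul _ _), integral_eq_of_ae_eq_indicator hW3 (fun y r => k (x - y) • r)
      (fun y => smul_zero _), integral_cutoff_gradient_eq hp hχ hχc hk x (hkD x hxD)]

/-- The pairs `(φ|_D, ∇φ|_D)` for `φ ∈ C^∞(ℝ^d)` with square integrable boundary values. -/
def smoothPairs (D : LipschitzDomain d) : Submodule ℝ (L2 D × L2vec D) :=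
  (smoothTriples D).map ((LinearMap.fst ℝ (L2 D) (L2vec D × L2bdry D)).prod
    (LinearMap.fst ℝ (L2vec D) (L2bdry D) ∘ₗ LinearMap.snd ℝ (L2 D) (L2vec D × L2bdry D)))

theorem memLp_volD_of_continuous {F : Type*} [NormedAddCommGroup F] {f : E d → F}
    (hf : Continuous f) : MemLp f 2 (volD D) := by
  have hK : IsCompact (closure D.carrier) := D.isBounded.isCompact_closure
  obtain ⟨C, hC⟩ := hK.exists_bound_of_continuousOn hf.continuousOn
  refine MemLp.of_bound hf.aestronglyMeasurable C ?_
  filter_upwards [ae_restrict_mem D.isOpen.measurableSet] with x hx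
  exact hC x (subset_closure hx)

theorem memLp_surface_of_continuous (hd : 1 ≤ d) {F : Type*} [NormedAddCommGroup F] {f : E d → F}
    (hf : Continuous f) : MemLp f 2 (surface D) := by
  have : IsFiniteMeasure (surface D) := ⟨surface_univ_lt_top hd D⟩
  have hK : IsCompact (frontier D.carrier) :=
    D.isBounded.isCompact_closure.of_isClosed_subset isClosed_frontier frontier_subset_closure
  obtain ⟨C, hC⟩ := hK.exists_bound_of_continuousOn hf.continuousOn
  refine MemLp.of_bound hf.aestronglyMeasurable C ?_
  filter_upwards [ae_restrict_mem isClosed_frontier.measurableSet] with x hx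
  exact hC x hx

theorem mem_smoothPairs (hd : 1 ≤ d) {φ : E d → ℝ} (hφ : ContDiff ℝ ∞ φ) {p : L2 D × L2vec D}
    (h1 : p.1 =ᵐ[volD D] φ) (h2 : p.2 =ᵐ[volD D] gradient φ) : p ∈ smoothPairs D :=
  ⟨(p.1, p.2, (memLp_surface_of_continuous hd hφ.continuous).toLp φ),
    ⟨φ, hφ, h1, h2, (memLp_surface_of_continuous hd hφ.continuous).coeFn_toLp⟩, rfl⟩

theorem cutoff_mem_closure (hd : 1 ≤ d) {p : L2 D × L2vec D} (hp : p ∈ H1 D) {χ : E d → ℝ}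
    (hχ : ContDiff ℝ ∞ χ) (hχc : HasCompactSupport χ)
    (hmol : ∀ ε > 0, ∃ k : E d → ℝ, ContDiff ℝ ∞ k ∧ HasCompactSupport k ∧ (∀ x, 0 ≤ k x) ∧
      ∫ x, k x = 1 ∧ tsupport k ⊆ Metric.closedBall 0 ε ∧
      ∀ x ∈ D.carrier, ∀ y ∈ tsupport χ, x - y ∈ tsupport k → y ∈ D.carrier) :
    cutoff D hχ hχc p ∈ (smoothPairs D).topologicalClosure := by
  rw [← SetLike.mem_coe, Submodule.topologicalClosure_coe, EMetric.mem_closure_iff]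
  intro ε hε
  obtain ⟨δ, hδ0, hδ⟩ := exists_between hε
  obtain ⟨φ, hφ, h1, h2⟩ := exists_smooth_near_cutoff hp hχ hχc hmol
    (η := δ ^ 2) (pow_ne_zero 2 hδ0.ne')
  have hm1 := memLp_volD_of_continuous (D := D) hφ.continuous
  have hm2 := memLp_volD_of_continuous (D := D) (continuous_gradient (hφ.of_le (by simp)))
  refine ⟨(hm1.toLp _, hm2.toLp _), mem_smoothPairs hd hφ hm1.coeFn_toLp hm2.coeFn_toLp, ?_⟩
  have key : ∀ {F : Type} [NormedAddCommGroup F] {f : E d → F} (hf : MemLp f 2 (volD D))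
      (g : Lp F 2 (volD D)), ∫⁻ x in D.carrier, ‖f x - g x‖ₑ ^ 2 ≤ δ ^ 2 →
      edist g (hf.toLp f) ≤ δ := by
    intro F _ f hf g h
    rw [edist_comm, Lp.edist_def, eLpNorm_congr_ae (hf.coeFn_toLp.sub (EventuallyEq.refl _ _))]
    rw [← sq_eLpNorm_two] at h
    exact (ENNReal.pow_le_pow_left_iff two_ne_zero).1 h
  rw [Prod.edist_eq]
  exact (max_le (key hm1 _ h1) (key hm2 _ h2)).trans_lt hδ

open scoped Manifold in
theorem exists_finite_partition {ι : Type} [Fintype ι] {s : Set (E d)} (hs : IsClosed s)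
    (U : ι → Set (E d)) (hU : ∀ i, IsOpen (U i)) (hb : ∀ i, Bornology.IsBounded (U i))
    (hsU : s ⊆ ⋃ i, U i) :
    ∃ χ : ι → E d → ℝ, (∀ i, ContDiff ℝ ∞ (χ i)) ∧ (∀ i, HasCompactSupport (χ i)) ∧
      (∀ i, tsupport (χ i) ⊆ U i) ∧ ∀ x ∈ s, ∑ i, χ i x = 1 := by
  obtain ⟨f, hf⟩ := SmoothPartitionOfUnity.exists_isSubordinate 𝓘(ℝ, E d) hs U hU hsU
  refine ⟨fun i => f i, fun i => (f i).contMDiff.contDiff, fun i => ?_, hf, fun x hx => ?_⟩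
  · exact Metric.isCompact_of_isClosed_isBounded (isClosed_tsupport _) ((hb i).subset (hf i))
  · rw [← f.sum_eq_one hx, finsum_eq_sum_of_fintype]

/-- Smooth functions are dense in `H¹(D)`. -/
theorem H1_le_closure_smoothPairs (hd : 1 ≤ d) : H1 D ≤ (smoothPairs D).topologicalClosure := by
  intro p hp
  have hK : IsCompact (closure D.carrier) := D.isBounded.isCompact_closure
  choose! ρ hρ hmol using fun x (hx : x ∈ closure D.carrier) => exists_mollifier D hx
  obtain ⟨t, htK, ht⟩ := hK.elim_nhds_subcover (fun x => Metric.ball x (ρ x))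
    (fun x hx => Metric.ball_mem_nhds x (hρ x hx))
  obtain ⟨χ, hχ, hχc, hχU, hsum⟩ := exists_finite_partition isClosed_closure
    (fun i : t => Metric.ball (i : E d) (ρ i)) (fun i => Metric.isOpen_ball)
    (fun i => Metric.isBounded_ball) (by simpa [iUnion_subtype] using ht)
  -- The cut-offs sum to 1 on the open set D, so their gradients cancel there and the gradient
  -- components of the pieces add up to `p.2`.
  have hgrad : ∀ x ∈ D.carrier, ∑ i, gradient (χ i) x = 0 := by
    intro x hx
    refine ext_inner_right ℝ fun u => ?_
    have h1 : (fun x => ∑ i, χ i x) =ᶠ[𝓝 x] fun _ => 1 := by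
      filter_upwards [D.isOpen.mem_nhds hx] with y hy
      exact hsum y (subset_closure hy)
    have h2 : fderiv ℝ (fun x => ∑ i, χ i x) x = 0 := by
      rw [h1.fderiv_eq, fderiv_const_apply]
    rw [fderiv_fun_sum fun i _ => (hχ i).differentiable (by simp) x] at h2
    rw [sum_inner, inner_zero_left]
    simp only [gradient_apply_eq]
    rw [← sum_apply, h2, zero_apply]
  have hp_eq : p = ∑ i, cutoff D (hχ i) (hχc i) p := by
    refine Prod.ext (Lp.ext ?_) (Lp.ext ?_)
    · rw [Prod.fst_sum]
      refine EventuallyEq.trans ?_ (Lp.coeFn_fun_finsetSum _ _).symm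
      have h1 : ∀ᵐ x ∂(volD D), ∀ i, (cutoff D (hχ i) (hχc i) p).1 x = χ i x • p.1 x :=
        ae_all_iff.2 fun i => (memLp_cutoff (hχ i).continuous (hχc i) p.1).coeFn_toLp
      filter_upwards [h1, ae_restrict_mem D.isOpen.measurableSet] with x hx hxD
      rw [Finset.sum_congr rfl fun i _ => hx i, ← Finset.sum_smul,
        hsum x (subset_closure hxD), one_smul]
    · rw [Prod.snd_sum]
      refine EventuallyEq.trans ?_ (Lp.coeFn_fun_finsetSum _ _).symm
      have h1 : ∀ᵐ x ∂(volD D), ∀ i, (cutoff D (hχ i) (hχc i) p).2 x =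
          χ i x • p.2 x + p.1 x • gradient (χ i) x :=
        ae_all_iff.2 fun i => (memLp_cutoff_gradient (hχ i) (hχc i) p).coeFn_toLp
      filter_upwards [h1, ae_restrict_mem D.isOpen.measurableSet] with x hx hxD
      rw [Finset.sum_congr rfl fun i _ => hx i, Finset.sum_add_distrib, ← Finset.sum_smul,
        ← Finset.smul_sum, hsum x (subset_closure hxD), one_smul, hgrad x hxD, smul_zero, add_zero]
  rw [hp_eq]
  refine Submodule.sum_mem _ fun i _ => ?_
  refine cutoff_mem_closure hd hp (hχ i) (hχc i) fun ε hε => ?_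
  obtain ⟨k, h1, h2, h3, h4, h5, h6⟩ := hmol i (htK i i.2) ε hε
  exact ⟨k, h1, h2, h3, h4, h5, fun x hx y hy => h6 x hx y (hχU i hy)⟩

end Density

/-! ## Traces and the Poincaré inequality in `H¹(D)` -/

section Sobolev

variable {d : ℕ} {D : LipschitzDomain d}

theorem sq_enorm_L2 {α F : Type*} [MeasurableSpace α] {μ : Measure α} [NormedAddCommGroup F]
    (f : Lp F 2 μ) : ‖f‖ₑ ^ 2 = ∫⁻ x, ‖f x‖ₑ ^ 2 ∂μ := by
  rw [Lp.enorm_def, sq_eLpNorm_two]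

theorem sq_enorm_eq_of_ae_eq {α F : Type*} [MeasurableSpace α] {μ : Measure α}
    [NormedAddCommGroup F] {f : Lp F 2 μ} {φ : α → F} (h : f =ᵐ[μ] φ) :
    ‖f‖ₑ ^ 2 = ∫⁻ x, ‖φ x‖ₑ ^ 2 ∂μ := by
  rw [sq_enorm_L2]
  refine lintegral_congr_ae ?_
  filter_upwards [h] with x hx
  rw [hx]

theorem norm_le_of_sq_enorm_le {X Y Z : Type*} [SeminormedAddCommGroup X]
    [SeminormedAddCommGroup Y] [SeminormedAddCommGroup Z] {C : NNReal} {x : X} {y : Y} {z : Z}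
    (h : ‖x‖ₑ ^ 2 ≤ C * (‖y‖ₑ ^ 2 + ‖z‖ₑ ^ 2)) : ‖x‖ ≤ √C * (‖y‖ + ‖z‖) := by
  have h1 : ‖x‖ ^ 2 ≤ C * (‖y‖ ^ 2 + ‖z‖ ^ 2) := by
    have : ‖x‖₊ ^ 2 ≤ C * (‖y‖₊ ^ 2 + ‖z‖₊ ^ 2) := by
      simp only [enorm_eq_nnnorm] at h
      exact_mod_cast h
    exact_mod_cast this
  refine abs_le_of_sq_le_sq' ?_ (by positivity) |>.2
  rw [mul_pow, Real.sq_sqrt (NNReal.coe_nonneg C)]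
  refine h1.trans (mul_le_mul_of_nonneg_left ?_ (NNReal.coe_nonneg C))
  nlinarith [norm_nonneg y, norm_nonneg z]

/-- The inequality is a closed condition on triples, so it passes from smooth functions to the
closure. -/
theorem exists_norm_trace_le (hd : 1 ≤ d) (D : LipschitzDomain d) :
    ∃ C : ℝ, 0 ≤ C ∧ ∀ t ∈ (smoothTriples D).topologicalClosure,
      ‖t.2.2‖ ≤ C * (‖t.1‖ + ‖t.2.1‖) := by
  obtain ⟨C, hC⟩ := exists_lintegral_surface_sq_le hd D
  refine ⟨√C, by positivity, fun t ht => ?_⟩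
  have hcl : IsClosed {t : L2 D × L2vec D × L2bdry D | ‖t.2.2‖ ≤ √C * (‖t.1‖ + ‖t.2.1‖)} :=
    isClosed_le (by fun_prop) (by fun_prop)
  refine closure_minimal ?_ hcl ht
  rintro t ⟨φ, hφ, h1, h2, h3⟩
  refine norm_le_of_sq_enorm_le ?_
  rw [sq_enorm_eq_of_ae_eq h1, sq_enorm_eq_of_ae_eq h2, sq_enorm_eq_of_ae_eq h3]
  exact hC φ (hφ.of_le (by simp))

/-- The constant function `1` in `L²(D)`. -/
abbrev oneL2 (D : LipschitzDomain d) : L2 D := Lp.const 2 (volD D) (1 : ℝ)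

/-- The Poincaré inequality in `H¹(D)`. -/
theorem exists_norm_sub_const_le (hd : 1 ≤ d) (D : LipschitzDomain d) :
    ∃ C : ℝ, 0 ≤ C ∧ ∀ p ∈ H1 D, ∃ c : ℝ, ‖p.1 - c • oneL2 D‖ ≤ C * ‖p.2‖ := by
  obtain ⟨C, hC⟩ := exists_lintegral_sub_sq_le_gradient D
  -- The constant supplied for φ need not depend continuously on φ. The orthogonal projection onto
  -- the constants is continuous and at least as good, so the inequality with it survives limits.
  set K : Submodule ℝ (L2 D) := ℝ ∙ oneL2 D with hK
  have hmin : ∀ v : L2 D, ∀ c : ℝ, ‖v - K.starProjection v‖ ≤ ‖v - c • oneL2 D‖ := by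
    intro v c
    rw [Submodule.starProjection_minimal]
    refine ciInf_le ⟨0, ?_⟩ (⟨c • oneL2 D, Submodule.mem_span_singleton.2 ⟨c, rfl⟩⟩ : K)
    rintro _ ⟨x, rfl⟩
    exact norm_nonneg _
  refine ⟨√C, by positivity, fun p hp => ?_⟩
  have hcl : IsClosed {p : L2 D × L2vec D | ‖p.1 - K.starProjection p.1‖ ≤ √C * ‖p.2‖} :=
    isClosed_le (by fun_prop) (by fun_prop)
  have h : ‖p.1 - K.starProjection p.1‖ ≤ √C * ‖p.2‖ := by
    refine closure_minimal ?_ hcl (H1_le_closure_smoothPairs hd hp)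
    rintro _ ⟨t, ⟨φ, hφ, h1, h2, -⟩, rfl⟩
    obtain ⟨c, hc⟩ := hC φ (hφ.of_le (by simp))
    have h3 : t.1 - c • oneL2 D =ᵐ[volD D] fun x => φ x - c := by
      filter_upwards [Lp.coeFn_sub t.1 (c • oneL2 D), Lp.coeFn_smul c (oneL2 D),
        Lp.coeFn_const (p := 2) (μ := volD D) (1 : ℝ), h1] with x e1 e2 e3 e4
      rw [e1, Pi.sub_apply, e2, Pi.smul_apply, e3, e4]
      simp
    have h4 : ‖t.1 - c • oneL2 D‖ ≤ √C * (‖t.2.1‖ + ‖(0 : ℝ)‖) := by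
      refine norm_le_of_sq_enorm_le ?_
      rw [sq_enorm_eq_of_ae_eq h3, sq_enorm_eq_of_ae_eq h2]
      simpa using hc
    rw [norm_zero, add_zero] at h4
    exact (hmin _ c).trans h4
  obtain ⟨c, hc⟩ := Submodule.mem_span_singleton.1 (K.starProjection_apply_mem p.1)
  exact ⟨c, by rwa [hc]⟩

/-- Every `v ∈ H¹(D)` has a trace. -/
theorem exists_isTrace (hd : 1 ≤ d) (v : H1 D) : ∃ g, IsTrace v g := by
  obtain ⟨C, hC0, hC⟩ := exists_norm_trace_le hd D
  set T := (smoothTriples D).topologicalClosure with hT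
  let π : T →L[ℝ] L2 D × L2vec D :=
    ((ContinuousLinearMap.fst ℝ (L2 D) (L2vec D × L2bdry D)).prod
      (ContinuousLinearMap.fst ℝ (L2vec D) (L2bdry D) ∘L
        ContinuousLinearMap.snd ℝ (L2 D) (L2vec D × L2bdry D))) ∘L T.subtypeL
  have hπ : ∀ t : T, π t = ((t : L2 D × L2vec D × L2bdry D).1,
      (t : L2 D × L2vec D × L2bdry D).2.1) := fun _ => rfl
  have hcomplete : CompleteSpace T :=
    (Submodule.isClosed_topologicalClosure _).completeSpace_coe
  -- The trace inequality bounds the boundary component by the other two, so forgetting it is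
  -- bounded below on the complete space T. The range is thus closed; containing the dense smooth
  -- pairs, it contains H¹(D).
  have hanti : AntilipschitzWith (1 + 2 * C).toNNReal π := by
    refine π.antilipschitz_of_bound fun t => ?_
    have h1 := hC t t.2
    have h2 : ‖(t : L2 D × L2vec D × L2bdry D).1‖ ≤ ‖π t‖ := norm_fst_le (π t)
    have h3 : ‖(t : L2 D × L2vec D × L2bdry D).2.1‖ ≤ ‖π t‖ := norm_snd_le (π t)
    have h4 : ‖π t‖ ≤ (1 + 2 * C) * ‖π t‖ := by nlinarith [norm_nonneg (π t)]
    rw [Real.coe_toNNReal _ (by positivity), Submodule.coe_norm, Prod.norm_def, Prod.norm_def]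
    refine max_le (h2.trans h4) (max_le (h3.trans h4) (h1.trans ?_))
    nlinarith [norm_nonneg (π t)]
  have hclosed : IsClosed (range π) := hanti.isClosed_range π.uniformContinuous
  have hsub : (smoothPairs D : Set (L2 D × L2vec D)) ⊆ range π := by
    rintro _ ⟨t, ht, rfl⟩
    exact ⟨⟨t, Submodule.le_topologicalClosure _ ht⟩, rfl⟩
  obtain ⟨t, ht⟩ := closure_minimal hsub hclosed (H1_le_closure_smoothPairs hd v.2)
  rw [hπ] at ht
  refine ⟨(t : L2 D × L2vec D × L2bdry D).2.2, ?_⟩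
  have h5 : ((v : L2 D × L2vec D).1, (v : L2 D × L2vec D).2,
      (t : L2 D × L2vec D × L2bdry D).2.2) = t := by
    rw [← ht]
  rw [IsTrace, h5]
  exact t.2

theorem isTrace_trace (hd : 1 ≤ d) (v : H1 D) : IsTrace v (trace D v) :=
  (exists_trace D).choose_spec v (exists_isTrace hd v)

/-- Traces are unique. -/
theorem IsTrace.eq_trace (hd : 1 ≤ d) {v : H1 D} {g : L2bdry D} (h : IsTrace v g) :
    trace D v = g := by
  obtain ⟨C, hC0, hC⟩ := exists_norm_trace_le hd D
  have h1 : IsTrace v (trace D v) := isTrace_trace hd v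
  have h2 := (smoothTriples D).topologicalClosure.sub_mem h1 h
  have h3 := hC _ h2
  simp only [Prod.fst_sub, Prod.snd_sub, sub_self, norm_zero, add_zero, mul_zero] at h3
  exact sub_eq_zero.1 (norm_le_zero_iff.1 h3)

theorem exists_norm_trace_le_H1 (hd : 1 ≤ d) (D : LipschitzDomain d) :
    ∃ C : ℝ, 0 ≤ C ∧ ∀ v : H1 D, ‖trace D v‖ ≤ C * ‖v‖ := by
  obtain ⟨C, hC0, hC⟩ := exists_norm_trace_le hd D
  refine ⟨2 * C, by positivity, fun v => (hC _ (isTrace_trace hd v)).trans ?_⟩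
  have h2 : ‖(v : L2 D × L2vec D).1‖ ≤ ‖v‖ := norm_fst_le (v : L2 D × L2vec D)
  have h3 : ‖(v : L2 D × L2vec D).2‖ ≤ ‖v‖ := norm_snd_le (v : L2 D × L2vec D)
  have := mul_le_mul_of_nonneg_left (add_le_add h2 h3) hC0
  dsimp only
  linarith

theorem trace_one (hd : 1 ≤ d) : trace D (oneH1 D) =ᵐ[surface D] fun _ => 1 := by
  have hm : MemLp (fun _ : E d => (1 : ℝ)) 2 (surface D) :=
    memLp_surface_of_continuous hd continuous_const
  have h : IsTrace (oneH1 D) (hm.toLp _) := by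
    refine subset_closure ⟨fun _ => 1, contDiff_const, Lp.coeFn_const (p := 2) _ _, ?_, hm.coeFn_toLp⟩
    filter_upwards [Lp.coeFn_zero (E d) 2 (volD D)] with x hx
    have : gradient (fun _ : E d => (1 : ℝ)) x = 0 := gradient_const x 1
    rw [this]
    exact hx
  rw [h.eq_trace hd]
  exact hm.coeFn_toLp

/-- For each test function both sides of the weak gradient identity are continuous L² pairings, so
H¹(D) is an intersection of closed sets. -/
theorem isClosed_H1 : IsClosed (H1 D : Set (L2 D × L2vec D)) := by
  have h : (H1 D : Set (L2 D × L2vec D)) =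
      ⋂ (φ : E d → ℝ) (_ : ContDiff ℝ ∞ φ) (_ : HasCompactSupport φ)
        (_ : tsupport φ ⊆ D.carrier), {p | ∫ x in D.carrier, p.1 x • gradient φ x =
          - ∫ x in D.carrier, φ x • p.2 x} := by
    ext p
    simp only [mem_iInter]
    exact Iff.rfl
  rw [h]
  refine isClosed_iInter fun φ => isClosed_iInter fun hφ => isClosed_iInter fun hc =>
    isClosed_iInter fun _ => ?_
  have h1 : MemLp (gradient φ) 2 (volD D) :=
    memLp_volD_of_continuous (continuous_gradient (hφ.of_le (by simp)))
  have h2 : MemLp φ 2 (volD D) := memLp_volD_of_continuous hφ.continuous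
  have e1 : ∀ v : L2 D, ∫ x in D.carrier, v x • gradient φ x =
      (ContinuousLinearMap.lsmul ℝ ℝ).lpPairing (volD D) 2 2 v (h1.toLp _) := by
    intro v
    rw [ContinuousLinearMap.lpPairing_eq_integral]
    refine integral_congr_ae ?_
    filter_upwards [h1.coeFn_toLp] with x hx
    rw [hx]
    rfl
  have e2 : ∀ G : L2vec D, ∫ x in D.carrier, φ x • G x =
      (ContinuousLinearMap.lsmul ℝ ℝ).lpPairing (volD D) 2 2 (h2.toLp _) G := by
    intro v
    rw [ContinuousLinearMap.lpPairing_eq_integral]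
    refine integral_congr_ae ?_
    filter_upwards [h2.coeFn_toLp] with x hx
    rw [hx]
    rfl
  simp only [e1, e2]
  exact isClosed_eq (by fun_prop) (by fun_prop)

instance : CompleteSpace (H1 D) := isClosed_H1.completeSpace_coe

end Sobolev

/-! ## The Hilbert space `𝓗` -/

section Hilbert

variable {d M : ℕ} {D : LipschitzDomain d} (El : Electrodes D M)

/-- `L²(E_k)`. -/
abbrev L2el (k : Fin M) : Type := Lp ℝ 2 ((surface D).restrict (El.set k))

/-- The restriction `L²(∂D) → L²(E_k)`. -/
def restrictEl (k : Fin M) : L2bdry D →L[ℝ] L2el El k :=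
  LpToLpRestrictCLM (E d) ℝ ℝ (surface D) 2 (El.set k)

theorem restrictEl_coeFn (k : Fin M) (g : L2bdry D) :
    restrictEl El k g =ᵐ[(surface D).restrict (El.set k)] g :=
  LpToLpRestrictCLM_coeFn ℝ (El.set k) g

theorem inner_restrictEl (k : Fin M) (f g : L2bdry D) :
    inner ℝ (restrictEl El k f) (restrictEl El k g) = ∫ x in El.set k, f x * g x ∂(surface D) := by
  rw [L2.inner_def]
  refine integral_congr_ae ?_
  filter_upwards [restrictEl_coeFn El k f, restrictEl_coeFn El k g] with x h1 h2
  rw [h1, h2, real_inner_eq_re_inner, mul_comm]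
  rfl

theorem inner_𝓗 (p q : 𝓗 El) : inner ℝ p q = inner ℝ (grad El p) (grad El q) +
    ∑ k, inner ℝ (restrictEl El k (jump El k p)) (restrictEl El k (jump El k q)) := by
  rw [Finset.sum_congr rfl fun k _ => inner_restrictEl El k (jump El k p) (jump El k q),
    L2.inner_def]
  rfl

theorem norm_sq_𝓗 (q : 𝓗 El) : ‖q‖ ^ 2 = ‖grad El q‖ ^ 2 +
    ∑ k, ‖restrictEl El k (jump El k q)‖ ^ 2 := by
  simp only [← real_inner_self_eq_norm_sq, inner_𝓗]

theorem norm_grad_le (q : 𝓗 El) : ‖grad El q‖ ≤ ‖q‖ := by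
  refine abs_le_of_sq_le_sq' ?_ (norm_nonneg q) |>.2
  rw [norm_sq_𝓗]
  exact le_add_of_nonneg_right (Finset.sum_nonneg fun k _ => sq_nonneg _)

theorem norm_restrictEl_jump_le (k : Fin M) (q : 𝓗 El) :
    ‖restrictEl El k (jump El k q)‖ ≤ ‖q‖ := by
  refine abs_le_of_sq_le_sq' ?_ (norm_nonneg q) |>.2
  rw [norm_sq_𝓗]
  refine le_trans ?_ (le_add_of_nonneg_left (sq_nonneg _))
  exact Finset.single_le_sum (f := fun k => ‖restrictEl El k (jump El k q)‖ ^ 2)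
    (fun k _ => sq_nonneg _) (Finset.mem_univ k)

/-- The trace of 1 equals 1 almost everywhere, and electrodes have positive surface measure. -/
theorem norm_restrictEl_trace_one_pos (hd : 1 ≤ d) (k : Fin M) :
    0 < ‖restrictEl El k (trace D (oneH1 D))‖ := by
  rw [norm_pos_iff]
  intro h
  have h1 : ∀ᵐ _ ∂((surface D).restrict (El.set k)), False := by
    filter_upwards [restrictEl_coeFn El k (trace D (oneH1 D)), ae_restrict_of_ae (trace_one hd),
      Lp.coeFn_zero ℝ 2 ((surface D).restrict (El.set k))] with x e1 e2 e3
    rw [h, e3, e2] at e1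
    simp at e1
  rw [ae_iff] at h1
  simp only [not_false_eq_true, ofPred_true, Measure.restrict_apply_univ] at h1
  exact (surface_electrode_pos hd El k).ne' h1

/-- Every class has a representative that is controlled by its norm in `𝓗`. -/
theorem exists_representative (hd : 1 ≤ d) : ∃ C : ℝ, 0 ≤ C ∧ ∀ q : 𝓗 El,
    ∃ p : H1 D × (Fin M → ℝ), cls El p = q ∧ ‖p‖ ≤ C * ‖q‖ := by
  obtain ⟨C₁, h₁, hC₁⟩ := exists_norm_sub_const_le hd D
  obtain ⟨C₂, h₂, hC₂⟩ := exists_norm_trace_le_H1 hd D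
  -- On E_k, the electrode value times the trace of 1 is the trace of the function minus the jump.
  -- Both are bounded by ‖q‖, and dividing by the norm of the trace of 1 bounds the electrode value.
  set A : Fin M → ℝ := fun k => (1 + ‖restrictEl El k‖ * (C₂ * (C₁ + 1))) /
    ‖restrictEl El k (trace D (oneH1 D))‖ with hA
  have hA0 : ∀ k, 0 ≤ A k := fun k => by positivity
  have hsum0 : 0 ≤ ∑ k, A k := Finset.sum_nonneg fun k _ => hA0 k
  refine ⟨C₁ + 1 + ∑ k, A k, by positivity, fun q => ?_⟩
  obtain ⟨⟨v, V⟩, rfl⟩ : ∃ p, cls El p = q := (constants D M).mkQ_surjective q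
  set q := cls El (v, V) with hq
  obtain ⟨c, hc⟩ := hC₁ v v.2
  -- Subtracting the Poincaré constant c from function and electrode values stays in the class and
  -- bounds the function in H¹(D) by its gradient.
  set p : H1 D × (Fin M → ℝ) := (v, V) - c • ((oneH1 D, fun _ => 1) : H1 D × (Fin M → ℝ)) with hp
  have hcls : cls El p = q := by
    rw [hp, map_sub, sub_eq_self]
    exact (Submodule.Quotient.mk_eq_zero _).2
      (Submodule.smul_mem _ _ (Submodule.mem_span_singleton_self _))
  have hq0 := norm_nonneg q
  have hgrad : (v : L2 D × L2vec D).2 = grad El q := rfl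
  have hp1 : ‖p.1‖ ≤ (C₁ + 1) * ‖q‖ := by
    have e1 : (p.1 : L2 D × L2vec D).1 = (v : L2 D × L2vec D).1 - c • oneL2 D := rfl
    have e2 : (p.1 : L2 D × L2vec D).2 = (v : L2 D × L2vec D).2 - c • (0 : L2vec D) := rfl
    have hg := norm_grad_le El q
    rw [Submodule.coe_norm, Prod.norm_def, e1, e2, smul_zero, sub_zero]
    rw [hgrad] at hc ⊢
    refine max_le (hc.trans ?_) (hg.trans ?_)
    · nlinarith
    · nlinarith
  refine ⟨p, hcls, ?_⟩
  have hsum : (C₁ + 1) * ‖q‖ ≤ (C₁ + 1 + ∑ k, A k) * ‖q‖ := by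
    rw [add_mul _ (∑ k, A k)]
    exact le_add_of_nonneg_right (mul_nonneg hsum0 hq0)
  rw [Prod.norm_def]
  refine max_le (hp1.trans hsum) ?_
  rw [pi_norm_le_iff_of_nonneg (by positivity)]
  intro k
  have hjump : restrictEl El k (jump El k q) = restrictEl El k (trace D p.1) -
      p.2 k • restrictEl El k (trace D (oneH1 D)) := by
    rw [← hcls, jump_cls, map_sub, map_sub, map_smul, map_smul]
  have hle : ‖p.2 k‖ * ‖restrictEl El k (trace D (oneH1 D))‖ ≤
      (1 + ‖restrictEl El k‖ * (C₂ * (C₁ + 1))) * ‖q‖ := by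
    rw [← norm_smul]
    have e : p.2 k • restrictEl El k (trace D (oneH1 D)) =
        restrictEl El k (trace D p.1) - restrictEl El k (jump El k q) := by
      rw [hjump, sub_sub_cancel]
    rw [e]
    calc ‖restrictEl El k (trace D p.1) - restrictEl El k (jump El k q)‖
        ≤ ‖restrictEl El k (trace D p.1)‖ + ‖restrictEl El k (jump El k q)‖ := norm_sub_le _ _
      _ ≤ ‖restrictEl El k‖ * (C₂ * ((C₁ + 1) * ‖q‖)) + ‖q‖ := by
          refine add_le_add ?_ (norm_restrictEl_jump_le El k q)
          refine ((restrictEl El k).le_opNorm _).trans ?_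
          gcongr
          exact (hC₂ p.1).trans (by gcongr)
      _ = _ := by ring
  have hk : ‖p.2 k‖ ≤ A k * ‖q‖ := by
    rw [hA]
    dsimp only
    rw [div_mul_eq_mul_div, le_div_iff₀ (norm_restrictEl_trace_one_pos El hd k)]
    exact hle
  refine hk.trans ?_
  gcongr
  have := Finset.single_le_sum (f := A) (fun k _ => hA0 k) (Finset.mem_univ k)
  linarith

theorem eq_zero_of_norm_eq_zero (hd : 1 ≤ d) {q : 𝓗 El} (hq : ‖q‖ = 0) : q = 0 := by
  obtain ⟨C, -, hC⟩ := exists_representative El hd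
  obtain ⟨p, rfl, hp⟩ := hC q
  rw [hq, mul_zero] at hp
  rw [norm_le_zero_iff.1 hp, map_zero]

instance [NeZero d] : NormedAddCommGroup (𝓗 El) :=
  { (inferInstance : SeminormedAddCommGroup (𝓗 El)) with
    eq_of_dist_eq_zero := fun {p q} h => by
      rw [dist_eq_norm] at h
      exact sub_eq_zero.1 (eq_zero_of_norm_eq_zero El (NeZero.one_le) h) }

theorem exists_norm_cls_le (hd : 1 ≤ d) : ∃ C : ℝ, ∀ p : H1 D × (Fin M → ℝ),
    ‖cls El p‖ ≤ C * ‖p‖ := by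
  obtain ⟨C₂, h₂, hC₂⟩ := exists_norm_trace_le_H1 hd D
  set A : Fin M → ℝ := fun k => ‖restrictEl El k‖ * (C₂ * (1 + ‖oneH1 D‖)) with hA
  refine ⟨√(1 + ∑ k, A k ^ 2), fun p => ?_⟩
  refine abs_le_of_sq_le_sq' ?_ (by positivity) |>.2
  have hA2 : 0 ≤ ∑ k, A k ^ 2 := Finset.sum_nonneg fun k _ => sq_nonneg _
  rw [norm_sq_𝓗, mul_pow, Real.sq_sqrt (by positivity), add_mul, one_mul, Finset.sum_mul]
  refine add_le_add ?_ (Finset.sum_le_sum fun k _ => ?_)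
  · have h1 : ‖(p.1 : L2 D × L2vec D).2‖ ≤ ‖p.1‖ := norm_snd_le (p.1 : L2 D × L2vec D)
    rw [grad_cls]
    gcongr
    exact h1.trans (norm_fst_le p)
  · rw [← mul_pow]
    gcongr
    rw [jump_cls]
    refine ((restrictEl El k).le_opNorm _).trans ?_
    rw [hA]
    dsimp only
    rw [mul_assoc, mul_assoc]
    gcongr
    refine (hC₂ _).trans ?_
    gcongr
    calc ‖p.1 - p.2 k • oneH1 D‖ ≤ ‖p.1‖ + ‖p.2 k • oneH1 D‖ := norm_sub_le _ _
      _ ≤ ‖p‖ + ‖p‖ * ‖oneH1 D‖ := by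
        rw [norm_smul]
        gcongr
        · exact norm_fst_le p
        · exact (norm_le_pi_norm p.2 k).trans (norm_snd_le p)
      _ = _ := by ring

/-- An absolutely convergent series in 𝓗 lifts, through the controlled representatives, to one in
the complete space H¹(D) ⊕ ℝ^M. Continuity of the class map carries its sum back. -/
instance [NeZero d] : CompleteSpace (𝓗 El) := by
  obtain ⟨C, hC0, hC⟩ := exists_representative El (NeZero.one_le (n := d))
  obtain ⟨C', hC'⟩ := exists_norm_cls_le El (NeZero.one_le (n := d))
  let T : H1 D × (Fin M → ℝ) →L[ℝ] 𝓗 El := (cls El).mkContinuous C' hC'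
  refine NormedAddCommGroup.completeSpace_of_summable_imp_tendsto fun u hu => ?_
  choose p hp hle using fun n => hC (u n)
  have hps : Summable p :=
    Summable.of_norm_bounded (hu.mul_left C) hle
  have hTs := T.hasSum hps.hasSum
  have hTu : (fun n => T (p n)) = u := funext hp
  rw [hTu] at hTs
  exact ⟨_, hTs.tendsto_sum_nat⟩

end Hilbert

/-! ## The operators of the variational problem -/

section Operators

variable {d M : ℕ} {D : LipschitzDomain d} (El : Electrodes D M)

/-- The gradient as a bounded operator on `𝓗`. -/
def gradL : 𝓗 El →L[ℝ] L2vec D :=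
  (grad El).mkContinuous 1 fun q => by rw [one_mul]; exact norm_grad_le El q

/-- The jump on the electrode `E_k` as a bounded operator on `𝓗`. -/
def jumpL (k : Fin M) : 𝓗 El →L[ℝ] L2el El k :=
  ((restrictEl El k : L2bdry D →ₗ[ℝ] L2el El k) ∘ₗ jump El k).mkContinuous 1 fun q => by
    rw [one_mul]
    exact norm_restrictEl_jump_le El k q

/-- Multiplication by bounded functions. -/
def mulL (D : LipschitzDomain d) : Linfty D →L[ℝ] L2vec D →L[ℝ] L2vec D :=
  (ContinuousLinearMap.lsmul ℝ ℝ).holderL (volD D) ∞ 2 2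

theorem inner_mulL (a : Linfty D) (G H : L2vec D) :
    inner ℝ (mulL D a G) H = ∫ x in D.carrier, a x * inner ℝ (G x) (H x) := by
  rw [L2.inner_def]
  refine integral_congr_ae ?_
  filter_upwards [(ContinuousLinearMap.lsmul ℝ ℝ).coeFn_holder (r := 2) a G] with x hx
  have h : mulL D a G x = a x • G x := hx
  rw [h, real_inner_smul_left]

/-- The functional `(v, V) ↦ ∑_m I_m V_m` on `𝓗`. -/
theorem exists_current_functional (hd : 1 ≤ d) {I : Fin M → ℝ} (hI : ∑ m, I m = 0) :
    ∃ ℓ : 𝓗 El →L[ℝ] ℝ, ∀ p, ℓ (cls El p) = ∑ m, I m * p.2 m := by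
  let ℓ₀ : H1 D × (Fin M → ℝ) →ₗ[ℝ] ℝ :=
    (∑ m, I m • LinearMap.proj m) ∘ₗ LinearMap.snd ℝ (H1 D) (Fin M → ℝ)
  have hℓ₀ : ∀ p, ℓ₀ p = ∑ m, I m * p.2 m := fun p => by simp [ℓ₀]
  -- The functional vanishes on constants exactly because the currents sum to zero.
  let ℓ₁ : 𝓗 El →ₗ[ℝ] ℝ := (constants D M).liftQ ℓ₀ (by
    unfold constants
    rw [Submodule.span_singleton_le_iff_mem, LinearMap.mem_ker, hℓ₀]
    simpa using hI)
  have hℓ₁ : ∀ p, ℓ₁ (cls El p) = ∑ m, I m * p.2 m := hℓ₀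
  obtain ⟨C, hC0, hC⟩ := exists_representative El hd
  refine ⟨ℓ₁.mkContinuous ((∑ m, |I m|) * C) fun q => ?_, hℓ₁⟩
  obtain ⟨p, rfl, hp⟩ := hC q
  rw [hℓ₁, mul_assoc, Finset.sum_mul]
  refine (norm_sum_le _ _).trans (Finset.sum_le_sum fun m _ => ?_)
  rw [norm_mul, Real.norm_eq_abs (I m)]
  gcongr
  exact ((norm_le_pi_norm p.2 m).trans (norm_snd_le p)).trans hp

variable [NeZero d]

/-- The operator `w ↦ (v ↦ ∫_D a ∇w·∇v)`, by the Riesz representation. -/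
def diffusion : Linfty D →L[ℝ] 𝓗 El →L[ℝ] 𝓗 El :=
  (ContinuousLinearMap.compL ℝ (𝓗 El) (L2vec D) (𝓗 El)
    (ContinuousLinearMap.adjoint (gradL El))) ∘L
    ((ContinuousLinearMap.compL ℝ (𝓗 El) (L2vec D) (L2vec D)).flip (gradL El)) ∘L mulL D

theorem inner_diffusion (a : Linfty D) (w v : 𝓗 El) :
    inner ℝ (diffusion El a w) v =
      ∫ x in D.carrier, a x * inner ℝ (grad El w x) (grad El v x) := by
  have h : diffusion El a w = ContinuousLinearMap.adjoint (gradL El) (mulL D a (gradL El w)) := rfl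
  rw [h, ContinuousLinearMap.adjoint_inner_left, inner_mulL]
  rfl

/-- The operator of the contact terms. -/
def contact (z : Fin M → ℝ) : 𝓗 El →L[ℝ] 𝓗 El :=
  ∑ m, (1 / z m) • (ContinuousLinearMap.adjoint (jumpL El m) ∘L jumpL El m)

theorem inner_contact (z : Fin M → ℝ) (w v : 𝓗 El) :
    inner ℝ (contact El z w) v =
      ∑ m, (1 / z m) * ∫ x in El.set m, jump El m w x * jump El m v x ∂(surface D) := by
  rw [contact, sum_apply, sum_inner]
  refine Finset.sum_congr rfl fun m _ => ?_
  rw [smul_apply, real_inner_smul_left, ContinuousLinearMap.comp_apply,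
    ContinuousLinearMap.adjoint_inner_left, ← inner_restrictEl]
  rfl

theorem inner_diffusion_add_contact (a : Linfty D) (z : Fin M → ℝ) (w v : 𝓗 El) :
    inner ℝ ((diffusion El a + contact El z) w) v = B a z w v := by
  rw [add_apply, inner_add_left, inner_diffusion, inner_contact]
  rfl

/-- Coercivity of `B`. -/
theorem isUnit_diffusion_add_contact {a : Linfty D} {z : Fin M → ℝ} (hz : ∀ m, 0 < z m)
    {amin : ℝ} (hamin : 0 < amin) (ha : ∀ᵐ x ∂(volD D), amin ≤ a x) :
    IsUnit (diffusion El a + contact El z) := by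
  -- The reciprocal of amin⁻¹ + ∑ z_m lies below amin and below every 1/z_m at once.
  obtain ⟨c, hc, hca, hcz⟩ : ∃ c : ℝ, 0 < c ∧ c ≤ amin ∧ ∀ m, c ≤ 1 / z m := by
    have hs : 0 ≤ ∑ m, z m := Finset.sum_nonneg fun m _ => (hz m).le
    have hi : 0 < amin⁻¹ := inv_pos.2 hamin
    refine ⟨(amin⁻¹ + ∑ m, z m)⁻¹, by positivity, ?_, fun m => ?_⟩
    · exact inv_le_of_inv_le₀ hamin (by linarith)
    · rw [one_div]
      refine inv_anti₀ (hz m) ?_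
      have := Finset.single_le_sum (f := z) (fun m _ => (hz m).le) (Finset.mem_univ m)
      linarith
  -- The Lax–Milgram argument: c‖v‖² ≤ |⟨Tv, v⟩| forces T to be invertible. The bound is checked
  -- separately on the gradient term and on each electrode term.
  refine ContinuousLinearMap.isUnit_of_forall_le_norm_inner_map _ (c := c.toNNReal)
    (Real.toNNReal_pos.2 hc) fun v => ?_
  refine le_trans ?_ (le_abs_self _)
  rw [inner_diffusion_add_contact, Real.coe_toNNReal _ hc.le, norm_sq_𝓗, add_mul, Finset.sum_mul, B]
  refine add_le_add ?_ (Finset.sum_le_sum fun m _ => ?_)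
  · rw [← real_inner_self_eq_norm_sq, L2.inner_def, ← integral_mul_const]
    refine integral_mono_ae ((integrable_grad_inner v v).mul_const c) ?_ ?_
    · have h := L2.integrable_inner (𝕜 := ℝ) (mulL D a (grad El v)) (grad El v)
      refine h.congr ?_
      filter_upwards [(ContinuousLinearMap.lsmul ℝ ℝ).coeFn_holder (r := 2) a (grad El v)] with x hx
      have h : mulL D a (grad El v) x = a x • grad El v x := hx
      rw [h, real_inner_smul_left]
    · filter_upwards [ha] with x hx
      rw [mul_comm]
      exact mul_le_mul_of_nonneg_right (hca.trans hx) real_inner_self_nonneg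
  · rw [← real_inner_self_eq_norm_sq, inner_restrictEl, mul_comm]
    exact mul_le_mul_of_nonneg_right (hcz m) (integral_nonneg fun x => mul_self_nonneg _)

end Operators

end PCEM

end

/-! ### The solution map and its parametric derivatives -/

theorem mainTheorem8 {d M : ℕ} (hd : 1 ≤ d) (hd3 : d ≤ 3) (hM : 2 ≤ M)
    (D : PCEM.LipschitzDomain d) (El : PCEM.Electrodes D M)
    (z I : Fin M → ℝ) (hz : ∀ m, 0 < z m) (hI : ∑ m, I m = 0)
    -- the coefficient, with values in `L^∞(D)`, and its parametric derivatives
    (a : (ℕ → ℝ) → PCEM.Linfty D) (da : PCEM.𝓕 → (ℕ → ℝ) → PCEM.Linfty D)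
    (hda : PCEM.IsMixedDerivs a da)
    (Ca σ : ℝ) (hCa : 1 ≤ Ca) (hσ : 1 ≤ σ)
    (ρ : ℕ → ℝ) (hρ : ∀ j, 0 ≤ ρ j) (hρsum : Summable ρ)
    (hbound : ∀ ν : PCEM.𝓕, ∀ y ∈ PCEM.Υ,
      ‖da ν y‖ ≤ Ca * ((ν.degree.factorial : ℕ) : ℝ) ^ σ * ν.prod fun j n => ρ j ^ n)
    (amin amax : ℝ) (hamin : 0 < amin)
    (hell : ∀ y ∈ PCEM.Υ, ∀ᵐ x ∂(PCEM.volD D), amin ≤ a y x ∧ a y x ≤ amax) :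
    -- the problem is uniquely solvable
    (∀ y ∈ PCEM.Υ, ∃! q : PCEM.𝓗 El, PCEM.IsSolution (a y) z I q) ∧
    ∀ u : (ℕ → ℝ) → PCEM.𝓗 El, (∀ y ∈ PCEM.Υ, PCEM.IsSolution (a y) z I (u y)) →
      -- first derivatives and their variational characterisation
      (∀ j, ∀ y ∈ PCEM.Υ, ∃ w : PCEM.𝓗 El, PCEM.HasPartialDerivAt u w j y ∧
        PCEM.IsDerivSolution (a y) (da (Finsupp.single j 1) y) z (u y) w ∧
        ∀ w', PCEM.IsDerivSolution (a y) (da (Finsupp.single j 1) y) z (u y) w' → w' = w) ∧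
      -- all mixed derivatives
      ∃ du : PCEM.𝓕 → (ℕ → ℝ) → PCEM.𝓗 El, PCEM.IsMixedDerivs u du := by
  have : NeZero d := ⟨by omega⟩
  obtain ⟨ℓ, hℓ⟩ := PCEM.exists_current_functional El hd hI
  set f : PCEM.𝓗 El := (InnerProductSpace.toDual ℝ (PCEM.𝓗 El)).symm ℓ with hf
  set F : (ℕ → ℝ) → PCEM.𝓗 El →L[ℝ] PCEM.𝓗 El := fun y =>
    PCEM.diffusion El (a y) + PCEM.contact El z with hF
  have hunit : ∀ y ∈ PCEM.Υ, IsUnit (F y) := fun y hy =>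
    PCEM.isUnit_diffusion_add_contact El hz hamin ((hell y hy).mono fun x hx => hx.1)
  have hinj : ∀ y ∈ PCEM.Υ, ∀ q, Ring.inverse (F y) (F y q) = q := fun y hy q => by
    change (Ring.inverse (F y) * F y) q = q
    rw [Ring.inverse_mul_cancel _ (hunit y hy), one_apply_eq_self]
  have hsurj : ∀ y ∈ PCEM.Υ, ∀ q, F y (Ring.inverse (F y) q) = q := fun y hy q => by
    change (F y * Ring.inverse (F y)) q = q
    rw [Ring.mul_inverse_cancel _ (hunit y hy), one_apply_eq_self]
  -- Testing against all classes (v, V) is testing against all of 𝓗, so being a solution means F(y)q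
  -- = f.
  have hsol : ∀ y ∈ PCEM.Υ, ∀ q, PCEM.IsSolution (a y) z I q ↔ q = Ring.inverse (F y) f := by
    intro y hy q
    have hf' : ∀ v V, inner ℝ f (PCEM.cls El (v, V)) = ∑ m, I m * V m := fun v V => by
      rw [hf, InnerProductSpace.toDual_symm_apply, hℓ]
    constructor
    · intro h
      have : F y q = f := by
        refine ext_inner_right ℝ fun p => ?_
        obtain ⟨⟨v, V⟩, rfl⟩ : ∃ r, PCEM.cls El r = p := (PCEM.constants D M).mkQ_surjective p
        rw [hF, PCEM.inner_diffusion_add_contact, h v V, hf']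
      rw [← this, hinj y hy]
    · rintro rfl v V
      rw [← PCEM.inner_diffusion_add_contact, ← hf' v V]
      exact congrArg (fun r => inner ℝ r _) (hsurj y hy f)
  -- The bounded linear map `diffusion` carries derivatives of a to derivatives of operators. The
  -- contact term does not depend on y and survives only at ν = 0.
  have hdF : PCEM.IsMixedDerivs F
      (fun ν y => PCEM.diffusion El (da ν y) + if ν = 0 then PCEM.contact El z else 0) := by
    refine ⟨fun y hy => ?_, fun ν y hy j => ?_⟩
    · simp only [if_pos, hda.1 y hy, hF]
    · have h1 : ν + Finsupp.single j 1 ≠ 0 := fun h => by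
        simpa using DFunLike.congr_fun h j
      have h2 := (hda.2 ν y hy j).map_clm (Y := PCEM.𝓗 El →L[ℝ] PCEM.𝓗 El) (PCEM.diffusion El)
      simp only [if_neg h1, add_zero]
      exact h2.add_const (X := PCEM.𝓗 El →L[ℝ] PCEM.𝓗 El) _
  obtain ⟨du, hdu⟩ := PCEM.exists_isMixedDerivs_inverse_apply hdF hunit f
  refine ⟨fun y hy => ⟨Ring.inverse (F y) f, (hsol y hy _).2 rfl, fun q hq => (hsol y hy q).1 hq⟩,
    fun u hu => ?_⟩
  have huF : ∀ y ∈ PCEM.Υ, u y = Ring.inverse (F y) f := fun y hy => (hsol y hy _).1 (hu y hy)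
  refine ⟨fun j y hy => ?_, du, fun y hy => (hdu.1 y hy).trans (huF y hy).symm, hdu.2⟩
  set b := da (Finsupp.single j 1) y with hb
  -- In operator form the variational equation of the derivative is F(y)w = -`diffusion` b u(y), so
  -- it has exactly one solution.
  have hder : ∀ w, PCEM.IsDerivSolution (a y) b z (u y) w ↔
      w = -Ring.inverse (F y) (PCEM.diffusion El b (u y)) := by
    intro w
    have h1 : PCEM.IsDerivSolution (a y) b z (u y) w ↔ F y w = -PCEM.diffusion El b (u y) := by
      constructor
      · intro h
        refine ext_inner_right ℝ fun v => ?_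
        rw [hF, PCEM.inner_diffusion_add_contact, h v, inner_neg_left, PCEM.inner_diffusion]
      · intro h v
        rw [← PCEM.inner_diffusion, ← inner_neg_left, ← h, hF, PCEM.inner_diffusion_add_contact]
    rw [h1]
    constructor
    · intro h
      rw [← map_neg, ← h, hinj y hy]
    · rintro rfl
      rw [map_neg, hsurj y hy]
  refine ⟨_, ?_, (hder _).2 rfl, fun w' hw' => (hder w').1 hw'⟩
  have hFj : PCEM.HasPartialDerivAt F (PCEM.diffusion El b) j y := by
    have h1 : PCEM.HasPartialDerivAt (fun y => PCEM.diffusion El (da 0 y) + PCEM.contact El z)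
        (PCEM.diffusion El b) j y := by
      have h2 := hda.2 0 y hy j
      rw [zero_add] at h2
      exact (h2.map_clm (Y := PCEM.𝓗 El →L[ℝ] PCEM.𝓗 El) (PCEM.diffusion El)).add_const
        (X := PCEM.𝓗 El →L[ℝ] PCEM.𝓗 El) _
    exact h1.congr_on (X := PCEM.𝓗 El →L[ℝ] PCEM.𝓗 El) hy fun y hy => by
      rw [hF, hda.1 y hy]
  have hc : PCEM.HasPartialDerivAt (fun _ => f) 0 j y := hasDerivAt_const (y j) f
  have h3 := (hFj.inverse (hunit y hy)).clm_apply hc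
  -- With F(y)⁻¹f = u(y), the derivative -F⁻¹(∂_jF)F⁻¹f is the solution found above. As u is
  -- determined only on Υ, the formula is transferred along the coordinate line inside Υ.
  have h4 : PCEM.HasPartialDerivAt u (-Ring.inverse (F y) (PCEM.diffusion El b (u y))) j y := by
    have e : -Ring.inverse (F y) (PCEM.diffusion El b (u y)) =
        (-(Ring.inverse (F y) * PCEM.diffusion El b * Ring.inverse (F y))) f +
          Ring.inverse (F y) 0 := by
      rw [huF y hy, map_zero, add_zero]
      rfl
    rw [e]
    exact h3.congr_on hy huF
  exact h4
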